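/- Let $\Bbbk$ be a commutative ring; chain complexes are unbounded complexes of $\Bbbk$-modules with differentials of degree $-1$, and all signs follow the Koszul rule. A *contraction* consists of chain complexes $A,B$ and maps $f\colon A\to B$, $g\colon B\to A$ of degree $0$ and $h\colon A\to A$ of degree $1$ such that $d_Bf=fd_A$, $d_Ag=gd_B$, $fg=1_B$, $d_Ah+hd_A=gf-1_A$, $fh=0$, $hh=0$, $hg=0$. It is *filtered* if $A$ and $B$ carry increasing, exhaustive filtrations $(F_p)_{p\in\mathbb Z}$ by subcomplexes with $F_p=0$ for some $p$, which are preserved by $f,g,h$. For a filtered complex $A$, $F_p(A^{\otimes n})$ is the sum of the images of $F_{i_1}A\otimes\cdots\otimes F_{i_n}A$ over $i_1+\cdots+i_n=p$. Let $\mathcal O$ be a symmetric operad in chain complexes. A *filtered contraction of $\mathcal O$-algebras* is a filtered contraction $(f,g,h)$ of $A$ onto $B$ in which $A$ and $B$ are $\mathcal O$-algebras, $f$ and $g$ are morphisms of $\mathcal O$-algebras, and there exist maps $h_n\colon A^{\otimes n}\to A^{\otimes n}$ ($n\ge 1$) with $h_1=h$ such that 1. for every $n\ge1$, $(f^{\otimes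 n},g^{\otimes n},h_n)$ is a filtered contraction of $A^{\otimes n}$ onto $B^{\otimes n}$ for the induced filtrations; 2. $\mu_Ah_n=(-1)^{|\mu|}h\mu_A$ for all homogeneous $\mu\in\mathcal O(n)$, $n\geq 1$, where $\mu_A\colon A^{\otimes n}\to A$ is the operation induced by $\mu$; 3. for all $p,q\ge1$, $(h_p\otimes1-1\otimes h_q)h_{p+q}=-h_{p+q}(h_p\otimes1-1\otimes h_q)=h_p\otimes h_q$ on $A^{\otimes(p+q)}$. It is called *symmetric* if the $h_n$ can be chosen to be, in addition, $\Sigma_n$-equivariant. **Theorem.** Let $(f,g,h)$ be a filtered contraction of $\mathcal O$-algebras of $A$ onto $B$. Let $t\colon A\to A$ be a perturbation, i.e. a map of degree $-1$ with $(d_A+t)^2=0$, such that $t(F_pA)\subseteq F_{p-1}A$ for all $p$ and such that $t$ is a derivation of $\mathcal O$-algebras, i.e. $t\mu_A=(-1)^{|\mu|}\mu_A\sum_{i+1+j=n}1^{\otimes i}\otimes t\otimes1^{\otimes j}$ for all $n\ge0$ and homogeneous $\mu\in\mathcal O(n)$. Then $1-ht$ is invertible, the series $\Sigma=\sum_{n\ge0}t(ht)^n$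 has, applied to any element of $A$, only finitely many non-zero terms, and $\Sigma=t(1-ht)^{-1}$. Put $$f'=f+f\Sigma h,\qquad g'=g+h\Sigma g,\qquad h'=h+h\Sigma h,\qquad t'=f\Sigma g.$$ Then $t'$ is a perturbation of $B$, and $(f',g',h')$ is a filtered contraction of $\mathcal O$-algebras of $(A,d_A+t)$ onto $(B,d_B+t')$, where the structure maps $\mu_A,\mu_B$ and the filtrations are unchanged; it is symmetric if $(f,g,h)$ is. In particular, $f'$ and $g'$ are morphisms of $\mathcal O$-algebras, $t'$ is a derivation of $\mathcal O$-algebras, and the perturbed differential $d_B+t'$ is compatible with the operations, so that $(B,d_B+t')$ is an $\mathcal O$-algebra. -/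

import Mathlib

open scoped TensorProduct

namespace HPT

universe u v v' w

/-! ### Graded modules, maps of a given degree, and Koszul signs

A chain complex over `k` is a `k`-module `A` with an internal grading `A = ⨁ i, 𝒜 i` over `ℤ`
together with a differential of degree `-1`. -/

/-- The sign `(-1)^m` as an element of `k`. -/
def ksign (k : Type u) [CommRing k] (m : ℤ) : k := ((m.negOnePow : ℤ) : k)

section Basic

variable {k : Type u} [CommRing k]
variable {M : Type v} [AddCommGroup M] [Module k M]
variable {N : Type v'} [AddCommGroup N] [Module k N]

/-- `f` is a map of degree `m`. -/
def IsHomog (ℳ : ℤ → Submodule k M) (𝒩 : ℤ → Submodule k N) (m : ℤ) (f : M →ₗ[k] N) : Prop :=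
  ∀ i, ∀ x ∈ ℳ i, f x ∈ 𝒩 (i + m)

/-- `d` is a differential: it has degree `-1` and `d ∘ d = 0`. -/
structure IsDifferential (ℳ : ℤ → Submodule k M) (d : M →ₗ[k] M) : Prop where
  deg : IsHomog ℳ ℳ (-1) d
  sq : d ∘ₗ d = 0

/-- `t` is a perturbation of the chain complex `(M, d)`: it has degree `-1` and `(d + t)² = 0`. -/
structure IsPerturbation (ℳ : ℤ → Submodule k M) (d t : M →ₗ[k] M) : Prop where
  deg : IsHomog ℳ ℳ (-1) t
  sq : (d + t) ∘ₗ (d + t) = 0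

/-- A contraction of the chain complex `(M, dM)` onto the chain complex `(N, dN)`. -/
structure IsContraction (ℳ : ℤ → Submodule k M) (𝒩 : ℤ → Submodule k N)
    (dM : M →ₗ[k] M) (dN : N →ₗ[k] N) (f : M →ₗ[k] N) (g : N →ₗ[k] M) (h : M →ₗ[k] M) :
    Prop where
  diffM : IsDifferential ℳ dM
  diffN : IsDifferential 𝒩 dN
  f_deg : IsHomog ℳ 𝒩 0 f
  g_deg : IsHomog 𝒩 ℳ 0 g
  h_deg : IsHomog ℳ ℳ 1 h
  f_chain : dN ∘ₗ f = f ∘ₗ dM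
  g_chain : dM ∘ₗ g = g ∘ₗ dN
  f_g : f ∘ₗ g = LinearMap.id
  homotopy : dM ∘ₗ h + h ∘ₗ dM = g ∘ₗ f - LinearMap.id
  f_h : f ∘ₗ h = 0
  h_h : h ∘ₗ h = 0
  h_g : h ∘ₗ g = 0

/-- `F` is an increasing, bounded below, exhaustive filtration of the chain complex `(M, d)`
by (graded) subcomplexes. -/
structure IsFiltration (ℳ : ℤ → Submodule k M) (d : M →ₗ[k] M) (F : ℤ → Submodule k M) :
    Prop where
  mono : Monotone F
  graded : ∀ p, F p ≤ ⨆ i, F p ⊓ ℳ i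
  subcomplex : ∀ p, F p ≤ (F p).comap d
  bddBelow : ∃ p, F p = ⊥
  exhaustive : ∀ x, ∃ p, x ∈ F p

/-- A filtered contraction. -/
structure IsFilteredContraction (ℳ : ℤ → Submodule k M) (𝒩 : ℤ → Submodule k N)
    (dM : M →ₗ[k] M) (dN : N →ₗ[k] N) (FM : ℤ → Submodule k M) (FN : ℤ → Submodule k N)
    (f : M →ₗ[k] N) (g : N →ₗ[k] M) (h : M →ₗ[k] M) : Prop where
  contraction : IsContraction ℳ 𝒩 dM dN f g h
  filM : IsFiltration ℳ dM FM
  filN : IsFiltration 𝒩 dN FN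
  f_fil : ∀ p, FM p ≤ (FN p).comap f
  g_fil : ∀ p, FN p ≤ (FM p).comap g
  h_fil : ∀ p, FM p ≤ (FM p).comap h

end Basic

section Tensor

variable {k : Type u} [CommRing k]
variable {A : Type v} [AddCommGroup A] [Module k A]
variable {B : Type v'} [AddCommGroup B] [Module k B]

/-- The linear map `A → A` given by `x ↦ (-1)^(a * b) x` for `x` of degree `a`: the Koszul sign
produced when a map of degree `b` moves past `x`. -/
noncomputable def sgn (𝒜 : ℤ → Submodule k A) [DirectSum.Decomposition 𝒜] (b : ℤ) :
    A →ₗ[k] A :=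
  DirectSum.toModule k ℤ A (fun a => ksign k (a * b) • (𝒜 a).subtype) ∘ₗ
    (DirectSum.decomposeLinearEquiv 𝒜).toLinearMap

/-- The projection of `A` onto its odd part (`odd = true`) or its even part (`odd = false`). -/
noncomputable def parityProj (𝒜 : ℤ → Submodule k A) [DirectSum.Decomposition 𝒜] (odd : Bool) :
    A →ₗ[k] A :=
  DirectSum.toModule k ℤ A (fun a => if decide (Odd a) = odd then (𝒜 a).subtype else 0) ∘ₗ
    (DirectSum.decomposeLinearEquiv 𝒜).toLinearMap

/-- The grading of `A^{⊗n}`. -/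
def tensorGr (𝒜 : ℤ → Submodule k A) (n : ℕ) (p : ℤ) : Submodule k (⨂[k]^n A) :=
  Submodule.span k
    {z | ∃ (a : Fin n → ℤ) (x : Fin n → A),
      (∀ i, x i ∈ 𝒜 (a i)) ∧ ∑ i, a i = p ∧ z = PiTensorProduct.tprod k x}

/-- The filtration of `A^{⊗n}` induced by a filtration `F` of `A`: its level `p` is the sum of the
images of `F i₁ ⊗ ⋯ ⊗ F iₙ` with `i₁ + ⋯ + iₙ = p`. -/
def tensorFil (F : ℤ → Submodule k A) (n : ℕ) (p : ℤ) : Submodule k (⨂[k]^n A) :=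
  Submodule.span k
    {z | ∃ (a : Fin n → ℤ) (x : Fin n → A),
      (∀ i, x i ∈ F (a i)) ∧ ∑ i, a i = p ∧ z = PiTensorProduct.tprod k x}

/-- The tensor power `φ^{⊗n}` of a map `φ` of degree `0` (for which there are no signs), or of an
arbitrary map when `n = 1`. -/
noncomputable def tensorPow (φ : A →ₗ[k] B) (n : ℕ) : ⨂[k]^n A →ₗ[k] ⨂[k]^n B :=
  PiTensorProduct.map (fun _ : Fin n => φ)

/-- For `φ` of degree `b`, the map `∑_{i+1+j=n} 1^{⊗i} ⊗ φ ⊗ 1^{⊗j}` on `A^{⊗n}`, with Koszul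
signs. For `φ` a differential (and `b = -1`) it is the tensor product differential. -/
noncomputable def derExt (𝒜 : ℤ → Submodule k A) [DirectSum.Decomposition 𝒜] (b : ℤ)
    (φ : A →ₗ[k] A) (n : ℕ) : ⨂[k]^n A →ₗ[k] ⨂[k]^n A :=
  ∑ i : Fin n, PiTensorProduct.map
    (fun j : Fin n => if j < i then sgn 𝒜 b else if j = i then φ else LinearMap.id)

/-- The tensor product `φ ⊗ ψ` on `A^{⊗(p+q)} = A^{⊗p} ⊗ A^{⊗q}` of a map `φ` and a map `ψ` of
degree `b`, with the Koszul sign `(φ ⊗ ψ)(x ⊗ y) = (-1)^(b|x|) φ x ⊗ ψ y`. -/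
noncomputable def tensorHom (𝒜 : ℤ → Submodule k A) [DirectSum.Decomposition 𝒜] (b : ℤ)
    {p q : ℕ} (φ : ⨂[k]^p A →ₗ[k] ⨂[k]^p A) (ψ : ⨂[k]^q A →ₗ[k] ⨂[k]^q A) :
    ⨂[k]^(p + q) A →ₗ[k] ⨂[k]^(p + q) A :=
  (TensorPower.mulEquiv (R := k) (M := A) (n := p) (m := q)).toLinearMap ∘ₗ
    TensorProduct.map (φ ∘ₗ tensorPow (sgn 𝒜 b) p) ψ ∘ₗ
    (TensorPower.mulEquiv (R := k) (M := A) (n := p) (m := q)).symm.toLinearMap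

/-- The Koszul sign of a permutation acting on a tensor whose factors have the given parities
(`true` is odd): a factor `-1` for every inversion between two odd factors. -/
def koszulSign {n : ℕ} (σ : Equiv.Perm (Fin n)) (e : Fin n → Bool) : ℤ :=
  ∏ i, ∏ j, if i < j ∧ σ j < σ i ∧ e i = true ∧ e j = true then -1 else 1

/-- The (left) action of `σ` on `A^{⊗n}` permuting the tensor factors, with Koszul signs:
the factor in position `i` is moved to position `σ i`. -/
noncomputable def koszulPerm (𝒜 : ℤ → Submodule k A) [DirectSum.Decomposition 𝒜] {n : ℕ}
    (σ : Equiv.Perm (Fin n)) : ⨂[k]^n A →ₗ[k] ⨂[k]^n A :=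
  ∑ e : Fin n → Bool, (koszulSign σ e : k) •
    ((PiTensorProduct.reindex k (fun _ : Fin n => A) σ).toLinearMap ∘ₗ
      PiTensorProduct.map (fun i => parityProj 𝒜 (e i)))

end Tensor

/-! ### Operads -/

/-- When an `n`-ary operation is plugged into slot `i` of an `m`-ary operation, giving an `l`-ary
operation, the slot `j ≠ i` of the outer operation becomes this slot of the composite. -/
def outerSlot {m n l : ℕ} (h : l + 1 = m + n) (i j : Fin m) (hj : j ≠ i) : Fin l :=
  ⟨if j < i then j.val else j.val + n - 1, by
    have h1 := i.isLt
    have h2 := j.isLt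
    have h3 : j.val ≠ i.val := fun e => hj (Fin.ext e)
    split_ifs with h4
    · have h5 : j.val < i.val := h4
      omega
    · have h5 : ¬ j.val < i.val := h4
      omega⟩

/-- In the same situation, the slot `r` of the inner operation becomes this slot of the
composite. -/
def innerSlot {m n l : ℕ} (h : l + 1 = m + n) (i : Fin m) (r : Fin n) : Fin l :=
  ⟨i.val + r.val, by
    have h1 := i.isLt
    have h2 := r.isLt
    omega⟩

/-- A symmetric operad in chain complexes over `k`, given by its complexes `O(n)`, the right
actions of the symmetric groups, the unit, and the partial compositions `∘ᵢ`
(`comp i h μ ν = μ ∘ᵢ ν`, slots being numbered from `0`). -/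
structure Operad (k : Type u) [CommRing k] where
  obj : ℕ → Type w
  [grp : ∀ n, AddCommGroup (obj n)]
  [mod : ∀ n, Module k (obj n)]
  gr : ∀ n, ℤ → Submodule k (obj n)
  internal : ∀ n, DirectSum.IsInternal (gr n)
  d : ∀ n, obj n →ₗ[k] obj n
  isDifferential : ∀ n, IsDifferential (gr n) (d n)
  /-- the right action `μ ↦ μσ` of the symmetric group -/
  act : ∀ n, Equiv.Perm (Fin n) → (obj n →ₗ[k] obj n)
  act_one : ∀ n, act n 1 = LinearMap.id
  act_mul : ∀ n (σ τ : Equiv.Perm (Fin n)), act n (σ * τ) = act n τ ∘ₗ act n σ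
  act_deg : ∀ n σ, IsHomog (gr n) (gr n) 0 (act n σ)
  act_d : ∀ n σ, d n ∘ₗ act n σ = act n σ ∘ₗ d n
  one : obj 1
  one_mem : one ∈ gr 1 0
  d_one : d 1 one = 0
  comp : ∀ {m n l : ℕ} (_ : Fin m) (_ : l + 1 = m + n), obj m →ₗ[k] obj n →ₗ[k] obj l
  comp_mem : ∀ {m n l : ℕ} (i : Fin m) (h : l + 1 = m + n) (a b : ℤ),
    ∀ μ ∈ gr m a, ∀ ν ∈ gr n b, comp i h μ ν ∈ gr l (a + b)
  d_comp : ∀ {m n l : ℕ} (i : Fin m) (h : l + 1 = m + n) (a : ℤ),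
    ∀ μ ∈ gr m a, ∀ ν : obj n,
      d l (comp i h μ ν) = comp i h (d m μ) ν + ksign k a • comp i h μ (d n ν)
  one_comp : ∀ {n : ℕ} (h : n + 1 = 1 + n) (ν : obj n), comp 0 h one ν = ν
  comp_one : ∀ {m : ℕ} (i : Fin m) (h : m + 1 = m + 1) (μ : obj m), comp i h μ one = μ
  /-- sequential associativity -/
  comp_assoc : ∀ {m n r p q s : ℕ} (i : Fin m) (j : Fin n) (h₁ : p + 1 = m + n)
    (h₂ : s + 1 = p + r) (h₃ : q + 1 = n + r) (h₄ : s + 1 = m + q)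
    (lam : obj m) (μ : obj n) (ν : obj r),
      comp (innerSlot h₁ i j) h₂ (comp i h₁ lam μ) ν = comp i h₄ lam (comp j h₃ μ ν)
  /-- parallel associativity -/
  comp_comm : ∀ {m n r p q s : ℕ} (i j : Fin m) (hij : i < j) (h₁ : p + 1 = m + n)
    (h₂ : s + 1 = p + r) (h₃ : q + 1 = m + r) (h₄ : s + 1 = q + n) (a b : ℤ)
    (lam : obj m), ∀ μ ∈ gr n a, ∀ ν ∈ gr r b,
      comp (outerSlot h₁ i j hij.ne') h₂ (comp i h₁ lam μ) ν =
        ksign k (a * b) • comp (outerSlot h₃ j i hij.ne) h₄ (comp j h₃ lam ν) μ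
  /-- equivariance: `(μσ) ∘ᵢ (ντ) = (μ ∘_{σ i} ν)ρ`, where `ρ` is the permutation of the slots of
  the composite that is determined by `σ` and `τ` -/
  comp_act : ∀ {m n l : ℕ} (i : Fin m) (h : l + 1 = m + n) (σ : Equiv.Perm (Fin m))
    (τ : Equiv.Perm (Fin n)) (ρ : Equiv.Perm (Fin l)),
    (∀ (j : Fin m) (hj : j ≠ i),
      ρ (outerSlot h i j hj) = outerSlot h (σ i) (σ j) (σ.injective.ne hj)) →
    (∀ r : Fin n, ρ (innerSlot h i r) = innerSlot h (σ i) (τ r)) →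
    ∀ (μ : obj m) (ν : obj n),
      comp i h (act m σ μ) (act n τ ν) = act l ρ (comp (σ i) h μ ν)

attribute [instance] Operad.grp Operad.mod

/-! ### Algebras over operads -/

section Algebras

variable {k : Type u} [CommRing k] (O : Operad.{u, w} k)
variable {A : Type v} [AddCommGroup A] [Module k A]
variable {B : Type v'} [AddCommGroup B] [Module k B]

/-- The maps `γ n : O(n) → Hom(A^{⊗n}, A)`, `μ ↦ μ_A`, make the chain complex `(A, d)` an algebra
over the operad `O`. -/
structure IsOpAlgebra (𝒜 : ℤ → Submodule k A) [DirectSum.Decomposition 𝒜] (d : A →ₗ[k] A)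
    (γ : ∀ n, O.obj n →ₗ[k] (⨂[k]^n A →ₗ[k] A)) : Prop where
  isDifferential : IsDifferential 𝒜 d
  deg : ∀ n a, ∀ μ ∈ O.gr n a, IsHomog (tensorGr 𝒜 n) 𝒜 a (γ n μ)
  /-- the structure maps are compatible with the differentials:
  `(dμ)_A = d μ_A - (-1)^|μ| μ_A d` -/
  diff : ∀ n a, ∀ μ ∈ O.gr n a,
    γ n (O.d n μ) = d ∘ₗ γ n μ - ksign k a • (γ n μ ∘ₗ derExt 𝒜 (-1) d n)
  one : ∀ x : Fin 1 → A, γ 1 O.one (PiTensorProduct.tprod k x) = x 0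
  /-- `(μ ∘ᵢ ν)_A = μ_A (1 ⊗ ⋯ ⊗ ν_A ⊗ ⋯ ⊗ 1)` -/
  comp : ∀ {m n l : ℕ} (i : Fin m) (h : l + 1 = m + n) (μ : O.obj m) (b : ℤ), ∀ ν ∈ O.gr n b,
    ∀ x : Fin l → A,
      γ l (O.comp i h μ ν) (PiTensorProduct.tprod k x) =
        γ m μ (PiTensorProduct.tprod k (fun j : Fin m =>
          if hj : j = i then γ n ν (PiTensorProduct.tprod k (fun r => x (innerSlot h i r)))
          else if j < i then sgn 𝒜 b (x (outerSlot h i j hj))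
          else x (outerSlot h i j hj)))
  act : ∀ n (σ : Equiv.Perm (Fin n)) (μ : O.obj n),
    γ n (O.act n σ μ) = γ n μ ∘ₗ koszulPerm 𝒜 σ

/-- `f` is a morphism of `O`-algebras from `(A, dA)` to `(B, dB)`. -/
structure IsOpMorphism (𝒜 : ℤ → Submodule k A) (ℬ : ℤ → Submodule k B)
    (dA : A →ₗ[k] A) (dB : B →ₗ[k] B)
    (γA : ∀ n, O.obj n →ₗ[k] (⨂[k]^n A →ₗ[k] A)) (γB : ∀ n, O.obj n →ₗ[k] (⨂[k]^n B →ₗ[k] B))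
    (f : A →ₗ[k] B) : Prop where
  deg : IsHomog 𝒜 ℬ 0 f
  chain : dB ∘ₗ f = f ∘ₗ dA
  map : ∀ n (μ : O.obj n), f ∘ₗ γA n μ = γB n μ ∘ₗ tensorPow f n

/-- `t` is a derivation of `O`-algebras of degree `b`:
`t μ_A = (-1)^(b|μ|) μ_A (∑ 1^{⊗i} ⊗ t ⊗ 1^{⊗j})`. -/
structure IsOpDerivation (𝒜 : ℤ → Submodule k A) [DirectSum.Decomposition 𝒜]
    (γ : ∀ n, O.obj n →ₗ[k] (⨂[k]^n A →ₗ[k] A)) (b : ℤ) (t : A →ₗ[k] A) : Prop where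
  deg : IsHomog 𝒜 𝒜 b t
  map : ∀ n a, ∀ μ ∈ O.gr n a,
    t ∘ₗ γ n μ = ksign k (a * b) • (γ n μ ∘ₗ derExt 𝒜 b t n)

variable (𝒜 : ℤ → Submodule k A) [DirectSum.Decomposition 𝒜]
variable (ℬ : ℤ → Submodule k B) [DirectSum.Decomposition ℬ]
variable (dA : A →ₗ[k] A) (dB : B →ₗ[k] B)
variable (γA : ∀ n, O.obj n →ₗ[k] (⨂[k]^n A →ₗ[k] A))
variable (γB : ∀ n, O.obj n →ₗ[k] (⨂[k]^n B →ₗ[k] B))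

/-- The contraction `(f, g, h)` is a contraction of `O`-algebras, as witnessed by the sequence of
higher homotopies `hn n : A^{⊗n} → A^{⊗n}` for `n ≥ 1` (the value `hn 0` is irrelevant). -/
structure IsOpContractionVia (f : A →ₗ[k] B) (g : B →ₗ[k] A) (h : A →ₗ[k] A)
    (hn : ∀ n, ⨂[k]^n A →ₗ[k] ⨂[k]^n A) : Prop where
  base : IsContraction 𝒜 ℬ dA dB f g h
  algA : IsOpAlgebra O 𝒜 dA γA
  algB : IsOpAlgebra O ℬ dB γB
  morf : IsOpMorphism O 𝒜 ℬ dA dB γA γB f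
  morg : IsOpMorphism O ℬ 𝒜 dB dA γB γA g
  hn_one : hn 1 = tensorPow h 1
  contraction : ∀ n, 1 ≤ n →
    IsContraction (tensorGr 𝒜 n) (tensorGr ℬ n) (derExt 𝒜 (-1) dA n) (derExt ℬ (-1) dB n)
      (tensorPow f n) (tensorPow g n) (hn n)
  compat : ∀ n, 1 ≤ n → ∀ a, ∀ μ ∈ O.gr n a, γA n μ ∘ₗ hn n = ksign k a • (h ∘ₗ γA n μ)
  pseudo_left : ∀ p q, 1 ≤ p → 1 ≤ q →
    (tensorHom 𝒜 0 (hn p) LinearMap.id - tensorHom 𝒜 1 LinearMap.id (hn q)) ∘ₗ hn (p + q) =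
      tensorHom 𝒜 1 (hn p) (hn q)
  pseudo_right : ∀ p q, 1 ≤ p → 1 ≤ q →
    -(hn (p + q) ∘ₗ
      (tensorHom 𝒜 0 (hn p) LinearMap.id - tensorHom 𝒜 1 LinearMap.id (hn q))) =
      tensorHom 𝒜 1 (hn p) (hn q)

/-- The contraction `(f, g, h)` is a filtered contraction of `O`-algebras: it is a filtered
contraction and it admits higher homotopies `hn` such that every
`(f^{⊗n}, g^{⊗n}, hn n)` is a filtered contraction for the induced filtrations. -/
def IsFilteredOpContraction (FA : ℤ → Submodule k A) (FB : ℤ → Submodule k B)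
    (f : A →ₗ[k] B) (g : B →ₗ[k] A) (h : A →ₗ[k] A) : Prop :=
  IsFilteredContraction 𝒜 ℬ dA dB FA FB f g h ∧
  ∃ hn : ∀ n, ⨂[k]^n A →ₗ[k] ⨂[k]^n A,
    IsOpContractionVia O 𝒜 ℬ dA dB γA γB f g h hn ∧
    ∀ n, 1 ≤ n →
      IsFilteredContraction (tensorGr 𝒜 n) (tensorGr ℬ n) (derExt 𝒜 (-1) dA n)
        (derExt ℬ (-1) dB n) (tensorFil FA n) (tensorFil FB n)
        (tensorPow f n) (tensorPow g n) (hn n)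

/-- The same notion with symmetric higher homotopies: in addition every `hn n` is equivariant for
the action of the symmetric group on `A^{⊗n}`. (In level `0` nothing has to be added: a map of
degree `1` from `A^{⊗0} = k` to itself vanishes, and `h μ_A = h g μ_B = 0` for `μ ∈ O(0)`.) -/
def IsSymmFilteredOpContraction (FA : ℤ → Submodule k A) (FB : ℤ → Submodule k B)
    (f : A →ₗ[k] B) (g : B →ₗ[k] A) (h : A →ₗ[k] A) : Prop :=
  IsFilteredContraction 𝒜 ℬ dA dB FA FB f g h ∧
  ∃ hn : ∀ n, ⨂[k]^n A →ₗ[k] ⨂[k]^n A,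
    IsOpContractionVia O 𝒜 ℬ dA dB γA γB f g h hn ∧
    (∀ n, 1 ≤ n →
      IsFilteredContraction (tensorGr 𝒜 n) (tensorGr ℬ n) (derExt 𝒜 (-1) dA n)
        (derExt ℬ (-1) dB n) (tensorFil FA n) (tensorFil FB n)
        (tensorPow f n) (tensorPow g n) (hn n)) ∧
    ∀ n, 1 ≤ n → ∀ σ : Equiv.Perm (Fin n), koszulPerm 𝒜 σ ∘ₗ hn n = hn n ∘ₗ koszulPerm 𝒜 σ

end Algebras

end HPT

namespace HPT

/-! ### The perturbation lemma for a single contraction -/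

section Ring

variable {R : Type*} [Ring R]

/-! Since `t` lowers the filtration and `h` preserves it, `h t` is locally nilpotent, so `1 - h t`
is invertible and `S = t (1 - h t)⁻¹` is a pointwise finite sum. The classical perturbation lemma
(`IsContraction.perturb`) rests on the identity `d S + S d + S g f S = 0` and the side conditions.

The same lemma applies to `A^{⊗n}` with the homotopy `h_n` and the perturbation `t_n = ∑ 1 ⊗ t ⊗ 1`,
giving a series `S_n` and new higher homotopies `h_n + h_n S_n h_n`. An operation `μ_A` intertwines
`h_n` with `h` and `t_n` with `t` up to the sign `(-1)^|μ|`, hence also `S_n` with `S`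
(`pertSeries_intertwine`). Everything about operations follows once the perturbed contraction of
`A^{⊗n}` is known to consist of the tensor powers `f'^{⊗n}`, `g'^{⊗n}` and the derivation extending
`t'`.

That identification (`perturb_tensor`) uses uniqueness: `g'` is the only section of `f` that is
killed by `h` and is a chain map for the perturbed differential (`eq_perturb_g`), and dually for
`f'`. To apply this in `A^{⊗n}` one needs `h_n g'^{⊗n} = 0`, which the splitting relations between
`h_p`, `h_q` and `h_{p+q}` provide (`hn_comp_tensorPow`). The splitting relations themselves survive
perturbation by a computation in a noncommutative ring (`mul_eq_mul_of_split`), and equivariance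
survives because permutations commute with `t_n`. -/

theorem series_differential {d t h w S : R} (hl : S = t + t * h * S) (hr : S = t + S * h * t)
    (hd : d * t + t * d + t * t = 0) (hw : d * h + h * d = w - 1) :
    d * S + S * d + S * w * S = 0 := by
  have hw' : w = d * h + h * d + 1 := by rw [hw]; abel
  have e1 : (1 - t * h) * S = t := by linear_combination (norm := noncomm_ring) hl
  have e2 : S * (1 - h * t) = t := by linear_combination (norm := noncomm_ring) hr
  have i1 : (1 + S * h) * (1 - t * h) = 1 := by
    linear_combination (norm := noncomm_ring) hr * h
  have i2 : (1 - h * t) * (1 + h * S) = 1 := by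
    linear_combination (norm := noncomm_ring) h * hl
  -- Both outer factors are invertible by `i1` and `i2`. Between them the unknown `S` disappears,
  -- and only the perturbation equation for `t` remains.
  have e : (1 - t * h) * (d * S + S * d + S * w * S) * (1 - h * t) = 0 := by
    calc _ = (1 - t * h) * d * (S * (1 - h * t)) + ((1 - t * h) * S) * d * (1 - h * t)
          + ((1 - t * h) * S) * w * (S * (1 - h * t)) := by noncomm_ring
      _ = d * t + t * d + t * t := by rw [e1, e2, hw']; noncomm_ring
      _ = 0 := hd
  calc _ = ((1 + S * h) * (1 - t * h)) * (d * S + S * d + S * w * S) *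
        ((1 - h * t) * (1 + h * S)) := by rw [i1, i2]; noncomm_ring
    _ = (1 + S * h) * ((1 - t * h) * (d * S + S * d + S * w * S) * (1 - h * t)) *
        (1 + h * S) := by noncomm_ring
    _ = 0 := by rw [e]; noncomm_ring

end Ring

section Perturbation

variable {k : Type*} [CommRing k]
variable {M : Type*} [AddCommGroup M] [Module k M]
variable {N : Type*} [AddCommGroup N] [Module k N]

/-- The operator `t (1 - h t)⁻¹`. -/
noncomputable def pertSeries (h t : M →ₗ[k] M) : M →ₗ[k] M :=
  -- `Ring.inverse` is `0` on non-units, so invertibility of `1 - h t` has to be supplied wherever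
  -- the inverse is used.
  t ∘ₗ Ring.inverse (LinearMap.id - h ∘ₗ t : Module.End k M)

variable {h t : M →ₗ[k] M}

theorem pertSeries_comp (hu : IsUnit (LinearMap.id - h ∘ₗ t : Module.End k M)) :
    pertSeries h t ∘ₗ (LinearMap.id - h ∘ₗ t) = t := by
  have := Ring.inverse_mul_cancel _ hu
  rw [Module.End.mul_eq_comp] at this
  rw [pertSeries, LinearMap.comp_assoc, this]
  rfl

theorem pertSeries_eq_right (hu : IsUnit (LinearMap.id - h ∘ₗ t : Module.End k M)) :
    pertSeries h t = t + pertSeries h t ∘ₗ h ∘ₗ t := by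
  have := pertSeries_comp hu
  rw [LinearMap.comp_sub, LinearMap.comp_id] at this
  exact sub_eq_iff_eq_add.1 this

theorem pertSeries_eq_left (hu : IsUnit (LinearMap.id - h ∘ₗ t : Module.End k M)) :
    pertSeries h t = t + t ∘ₗ h ∘ₗ pertSeries h t := by
  have := Ring.mul_inverse_cancel _ hu
  rw [Module.End.mul_eq_comp, LinearMap.sub_comp, LinearMap.id_comp, sub_eq_iff_eq_add] at this
  conv_lhs => rw [pertSeries, this]
  rw [LinearMap.comp_add]
  rfl

/-- A map `φ` of which every element is killed by some power makes `1 - φ` invertible. -/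
theorem isUnit_id_sub {φ : M →ₗ[k] M} (hφ : ∀ x, ∃ n : ℕ, (φ ^ n) x = 0) :
    IsUnit (LinearMap.id - φ : Module.End k M) := by
  rw [Module.End.isUnit_iff]
  constructor
  · rw [injective_iff_map_eq_zero]
    intro x hx
    have hx' : φ x = x := by
      rw [LinearMap.sub_apply, LinearMap.id_apply, sub_eq_zero] at hx
      exact hx.symm
    obtain ⟨n, hn⟩ := hφ x
    have : ∀ n : ℕ, (φ ^ n) x = x := by
      intro n
      induction n with
      | zero => rfl
      | succ n ih => rw [pow_succ, Module.End.mul_apply, hx', ih]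
    rw [← this n, hn]
  · intro x
    obtain ⟨n, hn⟩ := hφ x
    -- The preimage is the geometric series, truncated where it vanishes on `x`.
    refine ⟨(∑ i ∈ Finset.range n, φ ^ i) x, ?_⟩
    have := mul_neg_geom_sum φ n
    have := LinearMap.congr_fun this x
    simpa [hn] using this

theorem pow_mem_of_lowers {F : ℤ → Submodule k M} {φ : M →ₗ[k] M}
    (hφ : ∀ p, ∀ x ∈ F p, φ x ∈ F (p - 1)) (n : ℕ) (p : ℤ) (x : M) (hx : x ∈ F p) :
    (φ ^ n) x ∈ F (p - n) := by
  induction n with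
  | zero => simpa using hx
  | succ n ih =>
    rw [pow_succ', Module.End.mul_apply]
    have := hφ _ _ ih
    push_cast
    rwa [← sub_sub]

theorem exists_pow_eq_zero {𝓜 : ℤ → Submodule k M} {d : M →ₗ[k] M} {F : ℤ → Submodule k M}
    (hF : IsFiltration 𝓜 d F) {φ : M →ₗ[k] M}
    (hφ : ∀ p, ∀ x ∈ F p, φ x ∈ F (p - 1)) (x : M) : ∃ n : ℕ, (φ ^ n) x = 0 := by
  obtain ⟨p, hp⟩ := hF.exhaustive x
  obtain ⟨q, hq⟩ := hF.bddBelow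
  -- If `p < q` this exponent is `0`, which is right: `x` already lies in `F q = ⊥`.
  refine ⟨(p - q).toNat, ?_⟩
  have h1 := pow_mem_of_lowers hφ (p - q).toNat p x hp
  have h2 := hF.mono (show p - ((p - q).toNat : ℤ) ≤ q by omega) h1
  rw [hq] at h2
  simpa using h2

theorem pow_eq_zero_of_le {φ : M →ₗ[k] M} {x : M} {m n : ℕ} (hn : (φ ^ n) x = 0) (h : n ≤ m) :
    (φ ^ m) x = 0 := by
  obtain ⟨r, rfl⟩ := Nat.exists_eq_add_of_le' h
  rw [pow_add, Module.End.mul_apply, hn, map_zero]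

theorem pertSeries_eq_sum (hu : IsUnit (LinearMap.id - h ∘ₗ t : Module.End k M)) {x : M} {n : ℕ}
    (hn : ((h ∘ₗ t) ^ n) x = 0) :
    pertSeries h t x = ∑ i ∈ Finset.range n, t (((h ∘ₗ t) ^ i) x) := by
  have e : (LinearMap.id - h ∘ₗ t : M →ₗ[k] M) ((∑ i ∈ Finset.range n, (h ∘ₗ t) ^ i) x) = x := by
    have := LinearMap.congr_fun (mul_neg_geom_sum (h ∘ₗ t) n) x
    simpa [hn] using this
  have e2 := LinearMap.congr_fun (pertSeries_comp hu) ((∑ i ∈ Finset.range n, (h ∘ₗ t) ^ i) x)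
  rw [LinearMap.comp_apply, e] at e2
  rw [e2]
  simp [LinearMap.sum_apply]

theorem pertSeries_finite_support (hφ : ∀ x, ∃ n : ℕ, ((h ∘ₗ t) ^ n) x = 0) (x : M) :
    {n : ℕ | t (((h ∘ₗ t) ^ n) x) ≠ 0}.Finite := by
  obtain ⟨n, hn⟩ := hφ x
  refine (Set.finite_lt_nat n).subset fun m hm => ?_
  by_contra hmn
  exact hm (by rw [pow_eq_zero_of_le hn (not_lt.1 hmn), map_zero])

theorem pertSeries_eq_finsum (hφ : ∀ x, ∃ n : ℕ, ((h ∘ₗ t) ^ n) x = 0) (x : M) :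
    pertSeries h t x = ∑ᶠ n : ℕ, t (((h ∘ₗ t) ^ n) x) := by
  obtain ⟨n, hn⟩ := hφ x
  rw [pertSeries_eq_sum (isUnit_id_sub hφ) hn]
  refine (finsum_eq_sum_of_support_subset _ fun m hm => ?_).symm
  by_contra hmn
  refine hm ?_
  have : n ≤ m := by simpa using hmn
  simp only [pow_eq_zero_of_le hn this, map_zero]

variable {𝓜 : ℤ → Submodule k M} {𝓝 : ℤ → Submodule k N} {dM : M →ₗ[k] M} {dN : N →ₗ[k] N}
  {f : M →ₗ[k] N} {g : N →ₗ[k] M}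

theorem IsHomog.comp {P : Type*} [AddCommGroup P] [Module k P] {𝓟 : ℤ → Submodule k P} {a b c : ℤ}
    {φ : N →ₗ[k] P} {ψ : M →ₗ[k] N} (hφ : IsHomog 𝓝 𝓟 a φ) (hψ : IsHomog 𝓜 𝓝 b ψ)
    (hc : b + a = c) : IsHomog 𝓜 𝓟 c (φ ∘ₗ ψ) := fun i x hx => by
  rw [← hc, ← add_assoc]
  exact hφ _ _ (hψ _ _ hx)

theorem IsHomog.add {a : ℤ} {φ ψ : M →ₗ[k] N} (hφ : IsHomog 𝓜 𝓝 a φ) (hψ : IsHomog 𝓜 𝓝 a ψ) :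
    IsHomog 𝓜 𝓝 a (φ + ψ) := fun i x hx => add_mem (hφ i x hx) (hψ i x hx)

theorem IsHomog.pertSeries (hφ : ∀ x, ∃ n : ℕ, ((h ∘ₗ t) ^ n) x = 0)
    (hh : IsHomog 𝓜 𝓜 1 h) (ht : IsHomog 𝓜 𝓜 (-1) t) :
    IsHomog 𝓜 𝓜 (-1) (pertSeries h t) := fun i x hx => by
  obtain ⟨n, hn⟩ := hφ x
  rw [pertSeries_eq_sum (isUnit_id_sub hφ) hn]
  refine sum_mem fun m hm => ht _ _ ?_
  clear hm
  induction m with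
  | zero => simpa using hx
  | succ m ih =>
    rw [pow_succ', Module.End.mul_apply]
    have := hh.comp ht (neg_add_cancel 1) _ _ ih
    rwa [add_zero] at this

theorem pertSeries_mem {F : ℤ → Submodule k M} (hφ : ∀ x, ∃ n : ℕ, ((h ∘ₗ t) ^ n) x = 0)
    (hh : ∀ p, F p ≤ (F p).comap h) (ht : ∀ p, F p ≤ (F p).comap t) (p : ℤ) :
    F p ≤ (F p).comap (pertSeries h t) := fun x hx => by
  obtain ⟨n, hn⟩ := hφ x
  rw [Submodule.mem_comap, pertSeries_eq_sum (isUnit_id_sub hφ) hn]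
  refine sum_mem fun m hm => ht _ ?_
  clear hm
  induction m with
  | zero => simpa using hx
  | succ m ih =>
    rw [pow_succ', Module.End.mul_apply]
    exact hh _ (ht _ ih)

theorem pertSeries_differential (hu : IsUnit (LinearMap.id - h ∘ₗ t : Module.End k M))
    (hc : IsContraction 𝓜 𝓝 dM dN f g h) (ht : IsPerturbation 𝓜 dM t) (x : M) :
    dM (pertSeries h t x) + pertSeries h t (dM x) +
      pertSeries h t (g (f (pertSeries h t x))) = 0 := by
  have := series_differential (R := Module.End k M) (d := dM) (t := t) (h := h)
    (w := g ∘ₗ f) (S := pertSeries h t) (pertSeries_eq_left hu) (pertSeries_eq_right hu) ?_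
    hc.homotopy
  · exact LinearMap.congr_fun this x
  · have h1 : dM * dM = 0 := hc.diffM.sq
    have h2 : (dM + t) * (dM + t) = 0 := ht.sq
    linear_combination (norm := noncomm_ring) h2 - h1

/-- The chain map and homotopy equations are combinations of `key` with the two recursions for `S`,
after `d h` has been rewritten as `g f - 1 - h d`. The side conditions hold because every cross term
contains `f h`, `h h` or `h g`. -/
theorem IsContraction.perturb (hφ : ∀ x, ∃ n : ℕ, ((h ∘ₗ t) ^ n) x = 0)
    (hc : IsContraction 𝓜 𝓝 dM dN f g h) (ht : IsPerturbation 𝓜 dM t) :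
    IsContraction 𝓜 𝓝 (dM + t) (dN + f ∘ₗ pertSeries h t ∘ₗ g)
      (f + f ∘ₗ pertSeries h t ∘ₗ h) (g + h ∘ₗ pertSeries h t ∘ₗ g)
      (h + h ∘ₗ pertSeries h t ∘ₗ h) := by
  have hu := isUnit_id_sub hφ
  have key := pertSeries_differential hu hc ht
  have hS := IsHomog.pertSeries hφ hc.h_deg ht.deg
  have hl := LinearMap.congr_fun (pertSeries_eq_left hu)
  have hr := LinearMap.congr_fun (pertSeries_eq_right hu)
  set S := pertSeries h t
  have fc := LinearMap.congr_fun hc.f_chain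
  have gc := LinearMap.congr_fun hc.g_chain
  have fg := LinearMap.congr_fun hc.f_g
  have ho := LinearMap.congr_fun hc.homotopy
  have fh := LinearMap.congr_fun hc.f_h
  have hh := LinearMap.congr_fun hc.h_h
  have hg := LinearMap.congr_fun hc.h_g
  simp only [LinearMap.comp_apply, LinearMap.add_apply, LinearMap.sub_apply, LinearMap.id_apply,
    LinearMap.zero_apply] at *
  have dh : ∀ x, dM (h x) = g (f x) - x - h (dM x) := fun x => by rw [← ho]; abel
  have fS : (f + f ∘ₗ S ∘ₗ h) ∘ₗ (g + h ∘ₗ S ∘ₗ g) = LinearMap.id := by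
    ext x
    simp [fg, fh, hh, hg]
  have gch : (dM + t) ∘ₗ (g + h ∘ₗ S ∘ₗ g) = (g + h ∘ₗ S ∘ₗ g) ∘ₗ (dN + f ∘ₗ S ∘ₗ g) := by
    ext x
    have e := congrArg h (key (g x))
    have e2 := hl (g x)
    simp only [LinearMap.comp_apply, LinearMap.add_apply, map_add, map_zero, dh, ← gc] at *
    linear_combination (norm := abel) -e - e2
  have fch : (dN + f ∘ₗ S ∘ₗ g) ∘ₗ (f + f ∘ₗ S ∘ₗ h) = (f + f ∘ₗ S ∘ₗ h) ∘ₗ (dM + t) := by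
    ext x
    have e := congrArg f (key (h x))
    have e2 := congrArg f (hr x)
    have e3 := congrArg (fun y => f (S y)) (dh x)
    simp only [LinearMap.comp_apply, LinearMap.add_apply, map_add, map_zero, map_sub, fc] at *
    linear_combination (norm := abel) e + e2 - e3
  refine ⟨⟨hc.diffM.deg.add ht.deg, ht.sq⟩, ⟨hc.diffN.deg.add ?_, ?_⟩, hc.f_deg.add ?_,
    hc.g_deg.add ?_, hc.h_deg.add ?_, fch, gch, fS, ?_, ?_, ?_, ?_⟩
  · exact hc.f_deg.comp (hS.comp hc.g_deg rfl) rfl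
  · have e1 := LinearMap.congr_fun fS
    have e2 := LinearMap.congr_fun fch
    have e3 := LinearMap.congr_fun ht.sq
    generalize dN + f ∘ₗ S ∘ₗ g = d' at *
    generalize f + f ∘ₗ S ∘ₗ h = f' at *
    generalize g + h ∘ₗ S ∘ₗ g = g' at *
    ext x
    -- No expansion is needed: with `d' = d_B + t'`, one has `d' d' = d' d' f' g' = f' (d + t)² g' =
    -- 0`.
    rw [LinearMap.comp_apply, ← LinearMap.id_apply (R := k) x, ← e1]
    simp only [LinearMap.comp_apply] at e2 e3 ⊢
    rw [e2, e2, e3]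
    simp
  · exact hc.f_deg.comp (hS.comp hc.h_deg rfl) rfl
  · exact hc.h_deg.comp (hS.comp hc.g_deg rfl) rfl
  · exact hc.h_deg.comp (hS.comp hc.h_deg rfl) rfl
  · ext x
    have e := congrArg h (key (h x))
    have e2 := hl (h x)
    have e3 := congrArg h (hr x)
    simp only [LinearMap.comp_apply, LinearMap.add_apply, LinearMap.sub_apply, LinearMap.id_apply,
      map_add, map_zero, map_sub, dh] at *
    linear_combination (norm := abel) -e - e2 - e3
  all_goals
    ext x
    simp [fh, hh, hg]

theorem IsFilteredContraction.perturb_lowers {FM FN : ℤ → Submodule k _}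
    (hc : IsFilteredContraction 𝓜 𝓝 dM dN FM FN f g h)
    (htF : ∀ p, ∀ x ∈ FM p, t x ∈ FM (p - 1)) (x : M) : ∃ n : ℕ, ((h ∘ₗ t) ^ n) x = 0 :=
  exists_pow_eq_zero hc.filM (φ := h ∘ₗ t) (fun p x hx => hc.h_fil _ (htF p x hx)) x

theorem IsFilteredContraction.perturb {FM FN : ℤ → Submodule k _}
    (hc : IsFilteredContraction 𝓜 𝓝 dM dN FM FN f g h) (ht : IsPerturbation 𝓜 dM t)
    (htF : ∀ p, ∀ x ∈ FM p, t x ∈ FM (p - 1)) :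
    IsFilteredContraction 𝓜 𝓝 (dM + t) (dN + f ∘ₗ pertSeries h t ∘ₗ g) FM FN
      (f + f ∘ₗ pertSeries h t ∘ₗ h) (g + h ∘ₗ pertSeries h t ∘ₗ g)
      (h + h ∘ₗ pertSeries h t ∘ₗ h) := by
  have hφ := hc.perturb_lowers htF
  have ht' : ∀ p, FM p ≤ (FM p).comap t := fun p x hx => hc.filM.mono (by omega) (htF p x hx)
  have hS := pertSeries_mem hφ hc.h_fil ht'
  refine ⟨hc.contraction.perturb hφ ht, ?_, ?_, ?_, ?_, ?_⟩
  · exact ⟨hc.filM.mono, hc.filM.graded, fun p x hx => (FM p).add_mem (hc.filM.subcomplex p hx)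
      (ht' p hx), hc.filM.bddBelow, hc.filM.exhaustive⟩
  · exact ⟨hc.filN.mono, hc.filN.graded, fun p x hx => (FN p).add_mem (hc.filN.subcomplex p hx)
      (hc.f_fil p (hS p (hc.g_fil p hx))), hc.filN.bddBelow, hc.filN.exhaustive⟩
  · exact fun p x hx => (FN p).add_mem (hc.f_fil p hx) (hc.f_fil p (hS p (hc.h_fil p hx)))
  · exact fun p x hx => (FM p).add_mem (hc.g_fil p hx) (hc.h_fil p (hS p (hc.g_fil p hx)))
  · exact fun p x hx => (FM p).add_mem (hc.h_fil p hx) (hc.h_fil p (hS p (hc.h_fil p hx)))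

/-- The perturbed inclusion is determined by being a section of `f` that is annihilated by `h` and
compatible with the perturbed differential. -/
theorem IsContraction.eq_perturb_g (hu : IsUnit (LinearMap.id - h ∘ₗ t : Module.End k M))
    (hc : IsContraction 𝓜 𝓝 dM dN f g h) {g' : N →ₗ[k] M} {d' : N →ₗ[k] N}
    (h1 : h ∘ₗ g' = 0) (h2 : f ∘ₗ g' = LinearMap.id) (h3 : (dM + t) ∘ₗ g' = g' ∘ₗ d') :
    g' = g + h ∘ₗ pertSeries h t ∘ₗ g := by
  have hr := pertSeries_eq_right hu
  -- The homotopy formula on `g'` gives `h d g' = g - g'`, while `h (d + t) g' = h g' d' = 0`. Thus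
  -- `(1 - h t) g' = g`, and `1 + h S` is the inverse of `1 - h t`.
  have hg : g = g' - h ∘ₗ t ∘ₗ g' := by
    ext x
    have e1 := LinearMap.congr_fun hc.homotopy (g' x)
    have e2 := LinearMap.congr_fun h2 x
    have e3 := congrArg h (LinearMap.congr_fun h3 x)
    have e4 := LinearMap.congr_fun h1
    simp only [LinearMap.comp_apply, LinearMap.add_apply, LinearMap.sub_apply, LinearMap.id_apply,
      LinearMap.zero_apply, map_add] at *
    rw [e2, e4, map_zero, zero_add] at e1
    rw [e4] at e3
    linear_combination (norm := abel) e3 - e1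
  ext x
  have e := congrArg h (LinearMap.congr_fun hr (g' x))
  have e2 := LinearMap.congr_fun hg x
  simp only [LinearMap.comp_apply, LinearMap.add_apply, LinearMap.sub_apply, map_add] at *
  rw [e2]
  simp only [map_sub]
  linear_combination (norm := abel) -e

/-- The perturbed projection is determined by being a retraction of `g` that annihilates `h` and
is compatible with the perturbed differential. -/
theorem IsContraction.eq_perturb_f (hu : IsUnit (LinearMap.id - h ∘ₗ t : Module.End k M))
    (hc : IsContraction 𝓜 𝓝 dM dN f g h) {f' : M →ₗ[k] N} {d' : N →ₗ[k] N}
    (h1 : f' ∘ₗ h = 0) (h2 : f' ∘ₗ g = LinearMap.id) (h3 : d' ∘ₗ f' = f' ∘ₗ (dM + t)) :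
    f' = f + f ∘ₗ pertSeries h t ∘ₗ h := by
  have hl := pertSeries_eq_left hu
  -- Dually, `f' (1 - t h) = f`, and `1 + S h` inverts `1 - t h`.
  have hf : f = f' - f' ∘ₗ t ∘ₗ h := by
    ext x
    have e1 := congrArg f' (LinearMap.congr_fun hc.homotopy x)
    have e2 := LinearMap.congr_fun h2 (f x)
    have e3 := LinearMap.congr_fun h3 (h x)
    have e4 := LinearMap.congr_fun h1
    simp only [LinearMap.comp_apply, LinearMap.add_apply, LinearMap.sub_apply, LinearMap.id_apply,
      LinearMap.zero_apply, map_add, map_sub] at *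
    rw [e2, e4, add_zero] at e1
    rw [e4, map_zero] at e3
    linear_combination (norm := abel) -e3 - e1
  ext x
  have e := congrArg f' (LinearMap.congr_fun hl (h x))
  have e2 := LinearMap.congr_fun hf
  simp only [LinearMap.comp_apply, LinearMap.add_apply, LinearMap.sub_apply, map_add] at *
  rw [e2, e2]
  linear_combination (norm := abel) -e

end Perturbation

/-! ### Koszul signs, tensor powers and their derivations -/

section Sign

variable (k : Type*) [CommRing k]

theorem ksign_add (a b : ℤ) : ksign k (a + b) = ksign k a * ksign k b := by
  simp [ksign, Int.negOnePow_add]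

theorem ksign_zero : ksign k 0 = 1 := by simp [ksign]

theorem ksign_neg (a : ℤ) : ksign k (-a) = ksign k a := by simp [ksign]

theorem ksign_mul_self (a : ℤ) : ksign k a * ksign k a = 1 := by
  rw [← ksign_add, ksign, Int.negOnePow_even _ (Even.add_self a)]
  simp

theorem ksign_sum {ι : Type*} (s : Finset ι) (a : ι → ℤ) :
    ksign k (∑ i ∈ s, a i) = ∏ i ∈ s, ksign k (a i) := by
  classical
  induction s using Finset.induction_on with
  | empty => simp [ksign_zero]
  | insert i s hi ih => rw [Finset.sum_insert hi, Finset.prod_insert hi, ksign_add, ih]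

end Sign

section Graded

variable {k : Type*} [CommRing k]
variable {A : Type*} [AddCommGroup A] [Module k A]
variable {B : Type*} [AddCommGroup B] [Module k B]
variable {C : Type*} [AddCommGroup C] [Module k C]
variable (𝒜 : ℤ → Submodule k A) [DirectSum.Decomposition 𝒜]
variable (ℬ : ℤ → Submodule k B) [DirectSum.Decomposition ℬ]

theorem sgn_apply_of_mem (b : ℤ) {a : ℤ} {x : A} (hx : x ∈ 𝒜 a) :
    sgn 𝒜 b x = ksign k (a * b) • x := by
  rw [sgn, LinearMap.comp_apply, LinearEquiv.coe_coe, DirectSum.decomposeLinearEquiv_apply,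
    DirectSum.decompose_of_mem _ hx]
  exact (DirectSum.toModule_lof k a _).trans rfl

theorem parityProj_apply_of_mem (e : Bool) {a : ℤ} {x : A} (hx : x ∈ 𝒜 a) :
    parityProj 𝒜 e x = if decide (Odd a) = e then x else 0 := by
  rw [parityProj, LinearMap.comp_apply, LinearEquiv.coe_coe, DirectSum.decomposeLinearEquiv_apply,
    DirectSum.decompose_of_mem _ hx]
  refine (DirectSum.toModule_lof k a _).trans ?_
  split_ifs <;> rfl

variable {𝒜} in
theorem hom_ext_of_homogeneous {φ ψ : A →ₗ[k] C} (H : ∀ a, ∀ x ∈ 𝒜 a, φ x = ψ x) : φ = ψ :=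
  DirectSum.decompose_lhom_ext 𝒜 fun a => LinearMap.ext fun x => H a x x.2

theorem sgn_zero : sgn 𝒜 0 = LinearMap.id :=
  hom_ext_of_homogeneous (𝒜 := 𝒜) fun a x hx => by
    rw [sgn_apply_of_mem 𝒜 0 hx, mul_zero, ksign_zero, one_smul, LinearMap.id_apply]

theorem sgn_neg (b : ℤ) : sgn 𝒜 (-b) = sgn 𝒜 b :=
  hom_ext_of_homogeneous (𝒜 := 𝒜) fun a x hx => by
    rw [sgn_apply_of_mem 𝒜 _ hx, sgn_apply_of_mem 𝒜 _ hx, mul_neg, ksign_neg]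

theorem sgn_comp_sgn (b : ℤ) : sgn 𝒜 b ∘ₗ sgn 𝒜 b = LinearMap.id :=
  hom_ext_of_homogeneous (𝒜 := 𝒜) fun a x hx => by
    rw [LinearMap.comp_apply, sgn_apply_of_mem 𝒜 _ hx, map_smul, sgn_apply_of_mem 𝒜 _ hx,
      smul_smul, ksign_mul_self, one_smul, LinearMap.id_apply]

theorem sgn_comp {φ : A →ₗ[k] B} {c : ℤ} (hφ : IsHomog 𝒜 ℬ c φ) (b : ℤ) :
    sgn ℬ b ∘ₗ φ = ksign k (c * b) • (φ ∘ₗ sgn 𝒜 b) :=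
  hom_ext_of_homogeneous (𝒜 := 𝒜) fun a x hx => by
    rw [LinearMap.comp_apply, LinearMap.smul_apply, LinearMap.comp_apply,
      sgn_apply_of_mem 𝒜 _ hx, sgn_apply_of_mem ℬ _ (hφ a x hx), map_smul, smul_smul, add_mul,
      ksign_add, mul_comm]

variable {𝒜} in
-- A graded submodule is spanned by its homogeneous elements, on which the sign operator is a
-- scalar. This is where gradedness of the filtration enters.
theorem sgn_mem {F : Submodule k A} (hF : F ≤ ⨆ i, F ⊓ 𝒜 i) (b : ℤ) {x : A} (hx : x ∈ F) :
    sgn 𝒜 b x ∈ F := by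
  refine (hF.trans (iSup_le fun i y hy => ?_) : F ≤ F.comap (sgn 𝒜 b)) hx
  rw [Submodule.mem_comap, sgn_apply_of_mem 𝒜 b hy.2]
  exact F.smul_mem _ hy.1

variable {𝒜} in
theorem tensor_ext_of_homogeneous {n : ℕ} {φ ψ : ⨂[k]^n A →ₗ[k] C}
    (H : ∀ (a : Fin n → ℤ) (x : Fin n → A), (∀ i, x i ∈ 𝒜 (a i)) →
      φ (PiTensorProduct.tprod k x) = ψ (PiTensorProduct.tprod k x)) : φ = ψ := by
  classical
  refine PiTensorProduct.ext (MultilinearMap.ext fun x => ?_)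
  rw [show x = fun i => ∑ j ∈ (DirectSum.decompose 𝒜 (x i)).support,
      (DirectSum.decompose 𝒜 (x i) j : A) from
    funext fun i => (DirectSum.sum_support_decompose 𝒜 (x i)).symm]
  simp only [LinearMap.compMultilinearMap_apply]
  rw [MultilinearMap.map_sum_finset, map_sum, map_sum]
  exact Finset.sum_congr rfl fun r _ => H r _ fun i => Subtype.prop _

variable {𝒜} in
theorem tensorGr_ext {n : ℕ} {φ ψ : ⨂[k]^n A →ₗ[k] C}
    (H : ∀ p, ∀ z ∈ tensorGr 𝒜 n p, φ z = ψ z) : φ = ψ :=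
  tensor_ext_of_homogeneous fun a x hx =>
    H _ _ (Submodule.subset_span ⟨a, x, hx, rfl, rfl⟩)

theorem tensorPow_tprod (φ : A →ₗ[k] B) (n : ℕ) (x : Fin n → A) :
    tensorPow φ n (PiTensorProduct.tprod k x) = PiTensorProduct.tprod k fun i => φ (x i) :=
  PiTensorProduct.map_tprod _ _

theorem tensorPow_comp (φ : B →ₗ[k] C) (ψ : A →ₗ[k] B) (n : ℕ) :
    tensorPow (φ ∘ₗ ψ) n = tensorPow φ n ∘ₗ tensorPow ψ n :=
  PiTensorProduct.map_comp (fun _ => φ) (fun _ => ψ)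

theorem tensorPow_id (n : ℕ) :
    tensorPow (LinearMap.id : A →ₗ[k] A) n = LinearMap.id := PiTensorProduct.map_id

theorem tensorPow_sgn_apply (b : ℤ) {n : ℕ} {p : ℤ} {z : ⨂[k]^n A} (hz : z ∈ tensorGr 𝒜 n p) :
    tensorPow (sgn 𝒜 b) n z = ksign k (p * b) • z := by
  suffices tensorGr 𝒜 n p ≤
      LinearMap.eqLocus (tensorPow (sgn 𝒜 b) n) (ksign k (p * b) • LinearMap.id) from this hz
  refine Submodule.span_le.2 ?_
  rintro _ ⟨a, x, hx, rfl, rfl⟩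
  rw [SetLike.mem_coe, LinearMap.mem_eqLocus, tensorPow_tprod]
  simp only [fun i => sgn_apply_of_mem 𝒜 b (hx i)]
  rw [MultilinearMap.map_smul_univ, Finset.sum_mul, ksign_sum]
  rfl

theorem tensorPow_sgn_comp {n : ℕ} {φ : ⨂[k]^n A →ₗ[k] ⨂[k]^n B} {c : ℤ}
    (hφ : IsHomog (tensorGr 𝒜 n) (tensorGr ℬ n) c φ) (b : ℤ) :
    tensorPow (sgn ℬ b) n ∘ₗ φ = ksign k (c * b) • (φ ∘ₗ tensorPow (sgn 𝒜 b) n) :=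
  tensorGr_ext fun a x hx => by
    rw [LinearMap.comp_apply, LinearMap.smul_apply, LinearMap.comp_apply,
      tensorPow_sgn_apply 𝒜 _ hx, tensorPow_sgn_apply ℬ _ (hφ a x hx), map_smul, smul_smul, add_mul,
      ksign_add, mul_comm]

variable {𝒜} in
-- The source of every anticommutation between an operator on the left tensor factor and one on the
-- right.
theorem tensorPow_sgn_comp_of_odd {n : ℕ} {φ : ⨂[k]^n A →ₗ[k] ⨂[k]^n A} {c ε : ℤ}
    (hφ : IsHomog (tensorGr 𝒜 n) (tensorGr 𝒜 n) c φ) (h : Odd (c * ε)) :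
    tensorPow (sgn 𝒜 ε) n ∘ₗ φ = -(φ ∘ₗ tensorPow (sgn 𝒜 ε) n) := by
  refine (tensorPow_sgn_comp 𝒜 𝒜 hφ ε).trans (LinearMap.ext fun z => ?_)
  rw [ksign, Int.negOnePow_odd _ h]
  simp

theorem tensorPow_sgn_comp_self (b : ℤ) (n : ℕ) :
    tensorPow (sgn 𝒜 b) n ∘ₗ tensorPow (sgn 𝒜 b) n = LinearMap.id := by
  rw [← tensorPow_comp, sgn_comp_sgn, tensorPow_id]

/-! ### Derivations of tensor powers -/

/-- One summand of `derExt`, evaluated on a pure tensor. -/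
theorem map_derExt_summand (b : ℤ) (φ : A →ₗ[k] A) {n : ℕ} (i : Fin n) (x : Fin n → A) :
    PiTensorProduct.map (R := k)
      (fun j : Fin n => if j < i then sgn 𝒜 b else if j = i then φ else LinearMap.id)
      (PiTensorProduct.tprod k x) =
    PiTensorProduct.tprod k
      (Function.update (fun j => if j < i then sgn 𝒜 b (x j) else x j) i (φ (x i))) := by
  rw [PiTensorProduct.map_tprod]
  congr 1
  funext j
  rcases eq_or_ne j i with rfl | hj
  · simp
  · rw [Function.update_of_ne hj]
    split_ifs <;> rfl

theorem derExt_tprod (b : ℤ) (φ : A →ₗ[k] A) {n : ℕ} (x : Fin n → A) :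
    derExt 𝒜 b φ n (PiTensorProduct.tprod k x) = ∑ i, PiTensorProduct.tprod k
      (Function.update (fun j => if j < i then sgn 𝒜 b (x j) else x j) i (φ (x i))) := by
  rw [derExt, LinearMap.sum_apply]
  exact Finset.sum_congr rfl fun i _ => map_derExt_summand 𝒜 b φ i x

theorem derExt_add (b : ℤ) (φ ψ : A →ₗ[k] A) (n : ℕ) :
    derExt 𝒜 b (φ + ψ) n = derExt 𝒜 b φ n + derExt 𝒜 b ψ n := by
  refine PiTensorProduct.ext (MultilinearMap.ext fun x => ?_)
  simp only [LinearMap.compMultilinearMap_apply, LinearMap.add_apply, derExt_tprod,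
    MultilinearMap.map_update_add, Finset.sum_add_distrib]

theorem derExt_zero (b : ℤ) (φ : A →ₗ[k] A) : derExt 𝒜 b φ 0 = 0 := Finset.sum_empty

theorem derExt_one (b : ℤ) (φ : A →ₗ[k] A) : derExt 𝒜 b φ 1 = tensorPow φ 1 := by
  rw [derExt, Fin.sum_univ_one, tensorPow]
  congr 1
  funext j
  rw [Subsingleton.elim j 0]
  simp

variable {𝒜} in
theorem derExt_homog {b : ℤ} {φ : A →ₗ[k] A} (hφ : IsHomog 𝒜 𝒜 b φ) (n : ℕ) :
    IsHomog (tensorGr 𝒜 n) (tensorGr 𝒜 n) b (derExt 𝒜 b φ n) := by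
  intro p
  change tensorGr 𝒜 n p ≤ (tensorGr 𝒜 n (p + b)).comap (derExt 𝒜 b φ n)
  refine Submodule.span_le.2 ?_
  rintro _ ⟨a, x, hx, rfl, rfl⟩
  rw [SetLike.mem_coe, Submodule.mem_comap, derExt_tprod]
  refine sum_mem fun i _ => Submodule.subset_span ⟨a + Pi.single i b, _, fun j => ?_, ?_, rfl⟩
  · rcases eq_or_ne j i with rfl | hj
    · simpa using hφ _ _ (hx j)
    · rw [Function.update_of_ne hj, Pi.add_apply, Pi.single_eq_of_ne hj, add_zero]
      split_ifs
      · rw [sgn_apply_of_mem 𝒜 b (hx j)]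
        exact Submodule.smul_mem _ _ (hx j)
      · exact hx j
  · simp [Finset.sum_add_distrib]

variable {𝒜} in
-- Makes the perturbation series converge on every tensor power: each summand lowers exactly one of
-- the filtration indices by one.
theorem derExt_lowers {F : ℤ → Submodule k A} (hF : ∀ p, F p ≤ ⨆ i, F p ⊓ 𝒜 i) {b : ℤ}
    {φ : A →ₗ[k] A} (hφ : ∀ p, ∀ x ∈ F p, φ x ∈ F (p - 1)) (n : ℕ) (p : ℤ) :
    ∀ z ∈ tensorFil F n p, derExt 𝒜 b φ n z ∈ tensorFil F n (p - 1) := by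
  change tensorFil F n p ≤ (tensorFil F n (p - 1)).comap (derExt 𝒜 b φ n)
  refine Submodule.span_le.2 ?_
  rintro _ ⟨a, x, hx, rfl, rfl⟩
  rw [SetLike.mem_coe, Submodule.mem_comap, derExt_tprod]
  refine sum_mem fun i _ => Submodule.subset_span ⟨a - Pi.single i 1, _, fun j => ?_, ?_, rfl⟩
  · rcases eq_or_ne j i with rfl | hj
    · simpa using hφ _ _ (hx j)
    · rw [Function.update_of_ne hj, Pi.sub_apply, Pi.single_eq_of_ne hj, sub_zero]
      split_ifs
      · exact sgn_mem (hF _) b (hx j)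
      · exact hx j
  · simp [Finset.sum_sub_distrib]

variable {𝒜 ℬ} in
theorem derExt_comp_tensorPow {b : ℤ} {φ : A →ₗ[k] A} {φ' : B →ₗ[k] B} {ψ : A →ₗ[k] B}
    (hψ : IsHomog 𝒜 ℬ 0 ψ) (h : φ' ∘ₗ ψ = ψ ∘ₗ φ) (n : ℕ) :
    derExt ℬ b φ' n ∘ₗ tensorPow ψ n = tensorPow ψ n ∘ₗ derExt 𝒜 b φ n := by
  have hs := sgn_comp 𝒜 ℬ hψ b
  rw [zero_mul, ksign_zero, one_smul] at hs
  refine PiTensorProduct.ext (MultilinearMap.ext fun x => ?_)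
  simp only [LinearMap.compMultilinearMap_apply, LinearMap.comp_apply, tensorPow_tprod,
    derExt_tprod, map_sum]
  refine Finset.sum_congr rfl fun i _ => congrArg _ (funext fun j => ?_)
  rcases eq_or_ne j i with rfl | hj
  · simpa using LinearMap.congr_fun h (x j)
  · rw [Function.update_of_ne hj, Function.update_of_ne hj]
    split_ifs
    · exact LinearMap.congr_fun hs (x j)
    · rfl

/-! ### Splitting tensor powers -/

/-- The map `φ ⊗ ψ` on `A^{⊗(p+q)} = A^{⊗p} ⊗ A^{⊗q}`, without signs. -/
noncomputable def tmap {p q : ℕ} (φ : ⨂[k]^p A →ₗ[k] ⨂[k]^p B) (ψ : ⨂[k]^q A →ₗ[k] ⨂[k]^q B) :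
    ⨂[k]^(p + q) A →ₗ[k] ⨂[k]^(p + q) B :=
  (TensorPower.mulEquiv (R := k) (M := B) (n := p) (m := q)).toLinearMap ∘ₗ
    TensorProduct.map φ ψ ∘ₗ
    (TensorPower.mulEquiv (R := k) (M := A) (n := p) (m := q)).symm.toLinearMap

section tmap

variable {p q : ℕ}

theorem tmap_comp (φ : ⨂[k]^p B →ₗ[k] ⨂[k]^p C) (ψ : ⨂[k]^q B →ₗ[k] ⨂[k]^q C)
    (φ' : ⨂[k]^p A →ₗ[k] ⨂[k]^p B) (ψ' : ⨂[k]^q A →ₗ[k] ⨂[k]^q B) :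
    tmap φ ψ ∘ₗ tmap φ' ψ' = tmap (φ ∘ₗ φ') (ψ ∘ₗ ψ') := by
  ext z
  simp [tmap, TensorProduct.map_comp]

theorem tmap_id : tmap (LinearMap.id : ⨂[k]^p A →ₗ[k] _) (LinearMap.id : ⨂[k]^q A →ₗ[k] _) =
    LinearMap.id := by
  refine LinearMap.ext fun z => ?_
  simp [tmap]

theorem tmap_add_left (φ φ' : ⨂[k]^p A →ₗ[k] ⨂[k]^p B) (ψ : ⨂[k]^q A →ₗ[k] ⨂[k]^q B) :
    tmap (φ + φ') ψ = tmap φ ψ + tmap φ' ψ := by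
  simp only [tmap, TensorProduct.map_add_left, LinearMap.add_comp, LinearMap.comp_add]

theorem tmap_add_right (φ : ⨂[k]^p A →ₗ[k] ⨂[k]^p B) (ψ ψ' : ⨂[k]^q A →ₗ[k] ⨂[k]^q B) :
    tmap φ (ψ + ψ') = tmap φ ψ + tmap φ ψ' := by
  simp only [tmap, TensorProduct.map_add_right, LinearMap.add_comp, LinearMap.comp_add]

theorem tmap_smul_left (c : k) (φ : ⨂[k]^p A →ₗ[k] ⨂[k]^p B) (ψ : ⨂[k]^q A →ₗ[k] ⨂[k]^q B) :
    tmap (c • φ) ψ = c • tmap φ ψ := by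
  simp only [tmap, TensorProduct.map_smul_left, LinearMap.smul_comp, LinearMap.comp_smul]

theorem tmap_smul_right (c : k) (φ : ⨂[k]^p A →ₗ[k] ⨂[k]^p B) (ψ : ⨂[k]^q A →ₗ[k] ⨂[k]^q B) :
    tmap φ (c • ψ) = c • tmap φ ψ := by
  simp only [tmap, TensorProduct.map_smul_right, LinearMap.smul_comp, LinearMap.comp_smul]

theorem tmap_zero_left (ψ : ⨂[k]^q A →ₗ[k] ⨂[k]^q B) :
    tmap (0 : ⨂[k]^p A →ₗ[k] ⨂[k]^p B) ψ = 0 := by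
  rw [← zero_smul k (0 : ⨂[k]^p A →ₗ[k] ⨂[k]^p B), tmap_smul_left, zero_smul]

theorem tmap_zero_right (φ : ⨂[k]^p A →ₗ[k] ⨂[k]^p B) :
    tmap φ (0 : ⨂[k]^q A →ₗ[k] ⨂[k]^q B) = 0 := by
  rw [← zero_smul k (0 : ⨂[k]^q A →ₗ[k] ⨂[k]^q B), tmap_smul_right, zero_smul]

theorem tmap_neg_left (φ : ⨂[k]^p A →ₗ[k] ⨂[k]^p B) (ψ : ⨂[k]^q A →ₗ[k] ⨂[k]^q B) :
    tmap (-φ) ψ = -tmap φ ψ := by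
  rw [eq_neg_iff_add_eq_zero, ← tmap_add_left, neg_add_cancel, tmap_zero_left]

theorem tmap_neg_right (φ : ⨂[k]^p A →ₗ[k] ⨂[k]^p B) (ψ : ⨂[k]^q A →ₗ[k] ⨂[k]^q B) :
    tmap φ (-ψ) = -tmap φ ψ := by
  rw [eq_neg_iff_add_eq_zero, ← tmap_add_right, neg_add_cancel, tmap_zero_right]

theorem tmap_sub_left (φ φ' : ⨂[k]^p A →ₗ[k] ⨂[k]^p B) (ψ : ⨂[k]^q A →ₗ[k] ⨂[k]^q B) :
    tmap (φ - φ') ψ = tmap φ ψ - tmap φ' ψ := by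
  rw [sub_eq_add_neg, tmap_add_left, tmap_neg_left, sub_eq_add_neg]

theorem tmap_sub_right (φ : ⨂[k]^p A →ₗ[k] ⨂[k]^p B) (ψ ψ' : ⨂[k]^q A →ₗ[k] ⨂[k]^q B) :
    tmap φ (ψ - ψ') = tmap φ ψ - tmap φ ψ' := by
  rw [sub_eq_add_neg, tmap_add_right, tmap_neg_right, sub_eq_add_neg]

theorem tmap_sum_left {ι : Type*} (s : Finset ι) (φ : ι → (⨂[k]^p A →ₗ[k] ⨂[k]^p B))
    (ψ : ⨂[k]^q A →ₗ[k] ⨂[k]^q B) : tmap (∑ i ∈ s, φ i) ψ = ∑ i ∈ s, tmap (φ i) ψ := by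
  classical
  induction s using Finset.induction_on with
  | empty => simp [tmap_zero_left]
  | insert i s hi ih => rw [Finset.sum_insert hi, Finset.sum_insert hi, tmap_add_left, ih]

theorem tmap_sum_right {ι : Type*} (s : Finset ι) (φ : ⨂[k]^p A →ₗ[k] ⨂[k]^p B)
    (ψ : ι → (⨂[k]^q A →ₗ[k] ⨂[k]^q B)) : tmap φ (∑ i ∈ s, ψ i) = ∑ i ∈ s, tmap φ (ψ i) := by
  classical
  induction s using Finset.induction_on with
  | empty => simp [tmap_zero_right]
  | insert i s hi ih => rw [Finset.sum_insert hi, Finset.sum_insert hi, tmap_add_right, ih]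

theorem mulEquiv_tprod (x : Fin (p + q) → A) :
    TensorPower.mulEquiv (R := k) (M := A) (n := p) (m := q)
      (PiTensorProduct.tprod k (fun i => x (Fin.castAdd q i)) ⊗ₜ
        PiTensorProduct.tprod k (fun i => x (Fin.natAdd p i))) = PiTensorProduct.tprod k x := by
  have := TensorPower.tprod_mul_tprod k (fun i => x (Fin.castAdd q i))
    (fun i => x (Fin.natAdd p i))
  rw [TensorPower.gMul_def] at this
  rw [this, Fin.append_castAdd_natAdd]

theorem tmap_map (w : Fin (p + q) → (A →ₗ[k] B)) :
    tmap (p := p) (q := q) (PiTensorProduct.map fun i => w (Fin.castAdd q i))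
      (PiTensorProduct.map fun i => w (Fin.natAdd p i)) = PiTensorProduct.map w := by
  refine PiTensorProduct.ext (MultilinearMap.ext fun x => ?_)
  simp only [LinearMap.compMultilinearMap_apply]
  rw [← mulEquiv_tprod, tmap]
  simp only [LinearMap.comp_apply, LinearEquiv.coe_coe, LinearEquiv.symm_apply_apply,
    TensorProduct.map_tmul, PiTensorProduct.map_tprod]
  rw [mulEquiv_tprod (fun i => w i (x i)), mulEquiv_tprod, PiTensorProduct.map_tprod]

theorem tensorPow_add (φ : A →ₗ[k] B) :
    tensorPow φ (p + q) = tmap (tensorPow φ p) (tensorPow φ q) :=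
  (tmap_map fun _ : Fin (p + q) => φ).symm

/-- `φ` acts either in the first `p` slots or in the last `q`; in the second case it has passed the
whole left block, which yields the sign operator there. -/
theorem derExt_add_index (b : ℤ) (φ : A →ₗ[k] A) :
    derExt 𝒜 b φ (p + q) = tmap (derExt 𝒜 b φ p) LinearMap.id +
      tmap (tensorPow (sgn 𝒜 b) p) (derExt 𝒜 b φ q) := by
  rw [derExt, Fin.sum_univ_add, derExt, derExt, tmap_sum_left, tmap_sum_right]
  congr 1
  · refine Finset.sum_congr rfl fun i _ => ?_
    rw [← tmap_map, ← PiTensorProduct.map_id]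
    congr 2
    · funext j
      simp only [Fin.lt_def, Fin.ext_iff, Fin.val_castAdd]
    · funext j
      have h1 : ¬ Fin.natAdd p j < Fin.castAdd q i := by
        rw [Fin.lt_def, Fin.val_natAdd, Fin.val_castAdd]; omega
      have h2 : ¬ Fin.natAdd p j = Fin.castAdd q i := by
        rw [Fin.ext_iff, Fin.val_natAdd, Fin.val_castAdd]; omega
      rw [if_neg h1, if_neg h2]
  · refine Finset.sum_congr rfl fun i _ => ?_
    rw [← tmap_map, tensorPow]
    congr 2
    · funext j
      have h1 : Fin.castAdd q j < Fin.natAdd p i := by simp [Fin.lt_def]; omega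
      simp [h1]
    · simp [Fin.ext_iff]

theorem tensorHom_zero_id (φ : ⨂[k]^p A →ₗ[k] ⨂[k]^p A) (ψ : ⨂[k]^q A →ₗ[k] ⨂[k]^q A) :
    tensorHom 𝒜 0 φ ψ = tmap φ ψ := by
  change tmap (φ ∘ₗ tensorPow (sgn 𝒜 0) p) ψ = _
  rw [sgn_zero, tensorPow_id, LinearMap.comp_id]

theorem tensorHom_eq (b : ℤ) (φ : ⨂[k]^p A →ₗ[k] ⨂[k]^p A) (ψ : ⨂[k]^q A →ₗ[k] ⨂[k]^q A) :
    tensorHom 𝒜 b φ ψ = tmap (φ ∘ₗ tensorPow (sgn 𝒜 b) p) ψ := rfl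

end tmap

variable {𝒜} in
-- Splitting off the last factor leaves two squares, which vanish, and two cross terms, which cancel
-- because the odd map anticommutes with the sign operator.
theorem derExt_comp_self {φ : A →ₗ[k] A} (hφ : IsHomog 𝒜 𝒜 (-1) φ) (h : φ ∘ₗ φ = 0) (n : ℕ) :
    derExt 𝒜 (-1) φ n ∘ₗ derExt 𝒜 (-1) φ n = 0 := by
  induction n with
  | zero => rw [derExt_zero, LinearMap.zero_comp]
  | succ n ih =>
    have e1 : tensorPow φ 1 ∘ₗ tensorPow φ 1 = 0 := by
      rw [← tensorPow_comp, h]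
      refine PiTensorProduct.ext (MultilinearMap.ext fun x => ?_)
      exact (tensorPow_tprod _ _ _).trans (MultilinearMap.map_coord_zero _ 0 rfl)
    have e2 := tensorPow_sgn_comp_of_odd (ε := -1) (derExt_homog hφ n) (by decide)
    rw [derExt_add_index, derExt_one]
    simp only [LinearMap.add_comp, LinearMap.comp_add, tmap_comp, ih, e1, e2, LinearMap.id_comp,
      LinearMap.comp_id, tmap_zero_left, tmap_zero_right, tmap_neg_left]
    abel

end Graded

/-! ### Ring identities behind the splitting relations -/

section Ring

variable {R : Type*} [Ring R]

/-- To be read with `a = h_p ⊗ 1`, `b = 1 ⊗ h_q`, `s = d ⊗ 1`, `u = 1 ⊗ d`, `P = gf ⊗ 1`, `Q = 1 ⊗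
gf` and `H = h_{p+q}`. The homotopies `s` and `u` allow `z` to be replaced by `P z` and then by `Q P
z` under `H`, where `H P Q = 0` applies. -/
theorem mul_eq_zero_of_split {a b s u P Q H z : R} (hab : a * b = -(b * a))
    (hsb : s * b = -(b * s)) (hau : a * u = -(u * a)) (hs : s * a + a * s = P - 1)
    (hu : u * b + b * u = Q - 1) (hPb : P * b = b * P) (haP : a * P = 0) (hPQ : P * Q = Q * P)
    (hHPQ : H * (P * Q) = 0) (hH : H * (a - b) = -(a * b)) (haz : a * z = 0) (hbz : b * z = 0) :
    H * z = 0 := by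
  -- As `a z = 0`, the difference is `H a s z = H b s z - a b s z`, and `b s z = -s b z = 0`.
  have e1 : H * z = H * (P * z) := by
    linear_combination (norm := noncomm_ring)
      H * hs * z - H * s * haz - hH * s * z - (H - a) * (hsb * z - s * hbz)
  have haz' : a * (P * z) = 0 := by rw [← mul_assoc, haP, zero_mul]
  have hbz' : b * (P * z) = 0 := by rw [← mul_assoc, ← hPb, mul_assoc, hbz, mul_zero]
  have e2 : H * (P * z) = H * (Q * (P * z)) := by
    generalize P * z = y at *
    linear_combination (norm := noncomm_ring)
      H * hu * y - H * u * hbz' + hH * u * y - H * (hau * y - u * haz') - hab * u * y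
        + b * (hau * y - u * haz')
  rw [e1, e2, ← mul_assoc Q, ← hPQ, ← mul_assoc, hHPQ, zero_mul]

/-- Here `s = t ⊗ 1`, `u = 1 ⊗ t`, and the primed elements are `a' = (1 - a s)⁻¹ a`, `b' = (1 - b
u)⁻¹ b`, `H' = H (1 - T H)⁻¹`. Since `b u` commutes with `a` and `s`, the three inverses can be
cleared, and the unperturbed relation remains. -/
theorem mul_eq_mul_of_split {a b s u H T a' b' H' : R} (hab : a * b = -(b * a))
    (hsb : s * b = -(b * s)) (hau : a * u = -(u * a)) (hsu : s * u = -(u * s)) (hT : T = s + u)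
    (hH : (a - b) * H = a * b)
    (ha1 : a' = a + a * s * a') (ha2 : a' = a + a' * s * a)
    (hb1 : b' = b + b * u * b') (hb2 : b' = b + b' * u * b)
    (hH1 : H' = H + H * T * H') (hH2 : H' = H + H' * T * H) :
    (a' - b') * H' = a' * b' := by
  have ia : (1 + a' * s) * (1 - a * s) = 1 := by
    linear_combination (norm := noncomm_ring) ha2 * s
  have ib : (1 + b' * u) * (1 - b * u) = 1 := by
    linear_combination (norm := noncomm_ring) hb2 * u
  have iH : (1 - T * H) * (1 + T * H') = 1 := by
    linear_combination (norm := noncomm_ring) T * hH1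
  have ea : (1 - a * s) * a' = a := by linear_combination (norm := noncomm_ring) ha1
  have eb : (1 - b * u) * b' = b := by linear_combination (norm := noncomm_ring) hb1
  have eH : H' * (1 - T * H) = H := by linear_combination (norm := noncomm_ring) hH2
  have ca : (b * u) * a = a * (b * u) := by
    linear_combination (norm := noncomm_ring) b * hau - hab * u
  have cs : (b * u) * s = s * (b * u) := by
    linear_combination (norm := noncomm_ring) b * hsu - hsb * u
  have cc : (1 - b * u) * (1 - a * s) = (1 - a * s) * (1 - b * u) := by
    linear_combination (norm := noncomm_ring) ca * s + a * cs
  have e : (1 - b * u) * (1 - a * s) * ((a' - b') * H' - a' * b') * (1 - T * H) = 0 := by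
    calc _ = (1 - b * u) * ((1 - a * s) * a') * (H' * (1 - T * H))
          - (1 - b * u) * (1 - a * s) * b' * (H' * (1 - T * H))
          - (1 - b * u) * ((1 - a * s) * a') * b' * (1 - T * H) := by noncomm_ring
      _ = (1 - b * u) * a * H - (1 - a * s) * ((1 - b * u) * b') * H
          - a * ((1 - b * u) * b') * (1 - T * H) := by
        rw [ea, eH, cc]
        linear_combination (norm := noncomm_ring) ca * b' * (1 - T * H)
      _ = 0 := by
        rw [eb, hT]
        linear_combination (norm := noncomm_ring) hH - ca * H + a * hsb * H
  have e' : (a' - b') * H' - a' * b' = 0 := by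
    calc _ = (1 + a' * s) * ((1 + b' * u) * (1 - b * u)) * (1 - a * s) *
          ((a' - b') * H' - a' * b') * ((1 - T * H) * (1 + T * H')) := by
          rw [ib, iH, mul_one, mul_one, ia, one_mul]
      _ = (1 + a' * s) * (1 + b' * u) * ((1 - b * u) * (1 - a * s) *
          ((a' - b') * H' - a' * b') * (1 - T * H)) * (1 + T * H') := by noncomm_ring
      _ = 0 := by rw [e, mul_zero, zero_mul]
  exact sub_eq_zero.1 e'

open MulOpposite in
-- The mirror image, obtained in the opposite ring.
theorem mul_eq_zero_of_split' {a b s u P Q H z : R} (hab : a * b = -(b * a))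
    (hsb : s * b = -(b * s)) (hau : a * u = -(u * a)) (hs : s * a + a * s = P - 1)
    (hu : u * b + b * u = Q - 1) (hPb : P * b = b * P) (haP : P * a = 0) (hPQ : P * Q = Q * P)
    (hHPQ : P * Q * H = 0) (hH : (a - b) * H = a * b) (haz : z * a = 0) (hbz : z * b = 0) :
    z * H = 0 := by
  have := mul_eq_zero_of_split (a := op a) (b := op b) (s := op s) (u := op u) (P := op P)
    (Q := op Q) (H := op H) (z := op z)
    (congrArg op (show b * a = -(a * b) by rw [hab, neg_neg]))
    (congrArg op (show b * s = -(s * b) by rw [hsb, neg_neg]))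
    (congrArg op (show u * a = -(a * u) by rw [hau, neg_neg]))
    (congrArg op (show a * s + s * a = P - 1 by rw [add_comm, hs]))
    (congrArg op (show b * u + u * b = Q - 1 by rw [add_comm, hu]))
    (congrArg op hPb.symm) (congrArg op haP) (congrArg op hPQ.symm)
    (congrArg op (show Q * P * H = 0 by rw [← hPQ, hHPQ]))
    (congrArg op (show (a - b) * H = -(b * a) by rw [hH, hab])) (congrArg op haz)
    (congrArg op hbz)
  exact op_injective this

open MulOpposite in
-- Passing to the opposite ring reverses the product, whence `b' * a'`; the sign relating it to `a'
-- * b'` is supplied where anticommutation of the primed elements is known.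
theorem mul_eq_mul_of_split' {a b s u H T a' b' H' : R} (hab : a * b = -(b * a))
    (hsb : s * b = -(b * s)) (hau : a * u = -(u * a)) (hsu : s * u = -(u * s)) (hT : T = s + u)
    (hH : H * (a - b) = -(a * b))
    (ha1 : a' = a + a * s * a') (ha2 : a' = a + a' * s * a)
    (hb1 : b' = b + b * u * b') (hb2 : b' = b + b' * u * b)
    (hH1 : H' = H + H * T * H') (hH2 : H' = H + H' * T * H) :
    H' * (a' - b') = b' * a' := by
  simp only [mul_assoc] at ha1 ha2 hb1 hb2 hH1 hH2
  have := mul_eq_mul_of_split (a := op a) (b := op b) (s := op s) (u := op u) (H := op H)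
    (T := op T) (a' := op a') (b' := op b') (H' := op H')
    (congrArg op (show b * a = -(a * b) by rw [hab, neg_neg]))
    (congrArg op (show b * s = -(s * b) by rw [hsb, neg_neg]))
    (congrArg op (show u * a = -(a * u) by rw [hau, neg_neg]))
    (congrArg op (show u * s = -(s * u) by rw [hsu, neg_neg]))
    (congrArg op hT) (congrArg op (show H * (a - b) = b * a by rw [hH, hab, neg_neg]))
    (congrArg op ha2) (congrArg op ha1) (congrArg op hb2) (congrArg op hb1)
    (congrArg op hH2) (congrArg op hH1)
  exact op_injective this

end Ring

/-! ### Recursions and intertwiners for the perturbation series -/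

section Perturbation

variable {k : Type*} [CommRing k]
variable {M : Type*} [AddCommGroup M] [Module k M]
variable {N : Type*} [AddCommGroup N] [Module k N]
variable {h t : M →ₗ[k] M}

theorem perturb_h_left (hu : IsUnit (LinearMap.id - h ∘ₗ t : Module.End k M)) :
    h + h ∘ₗ pertSeries h t ∘ₗ h = h + (h ∘ₗ t) ∘ₗ (h + h ∘ₗ pertSeries h t ∘ₗ h) := by
  conv_lhs => rw [pertSeries_eq_left hu]
  ext x
  simp

theorem perturb_h_right (hu : IsUnit (LinearMap.id - h ∘ₗ t : Module.End k M)) :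
    h + h ∘ₗ pertSeries h t ∘ₗ h = h + ((h + h ∘ₗ pertSeries h t ∘ₗ h) ∘ₗ t) ∘ₗ h := by
  conv_lhs => rw [pertSeries_eq_right hu]
  ext x
  simp

theorem comp_right_cancel_of_isUnit {φ : M →ₗ[k] M} (hφ : IsUnit (φ : Module.End k M))
    {X Y : M →ₗ[k] N} (e : X ∘ₗ φ = Y ∘ₗ φ) : X = Y := by
  have hs := ((Module.End.isUnit_iff φ).1 hφ).2
  refine LinearMap.ext fun x => ?_
  obtain ⟨y, rfl⟩ := hs x
  exact LinearMap.congr_fun e y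

/-- Moving `K` past `h t` costs `c * c = 1`, so `K (1 - h t) = (1 - h' t') K`; the claim follows on
cancelling `1 - h t`. It is applied to `K = μ_A` with `c = (-1)^|μ|` and to permutations with `c =
1`. -/
theorem pertSeries_intertwine {h' t' : N →ₗ[k] N} {K : M →ₗ[k] N} {c : k} (hc : c * c = 1)
    (hu : IsUnit (LinearMap.id - h ∘ₗ t : Module.End k M))
    (hu' : IsUnit (LinearMap.id - h' ∘ₗ t' : Module.End k N))
    (hh : K ∘ₗ h = c • (h' ∘ₗ K)) (ht : K ∘ₗ t = c • (t' ∘ₗ K)) :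
    K ∘ₗ pertSeries h t = c • (pertSeries h' t' ∘ₗ K) := by
  have e : (K ∘ₗ pertSeries h t) ∘ₗ (LinearMap.id - h ∘ₗ t) =
      (c • (pertSeries h' t' ∘ₗ K)) ∘ₗ (LinearMap.id - h ∘ₗ t) := by
    rw [LinearMap.comp_assoc, pertSeries_comp hu]
    ext x
    have hh' := LinearMap.congr_fun hh
    have ht' := LinearMap.congr_fun ht
    have hr := LinearMap.congr_fun (pertSeries_eq_right hu')
    simp only [LinearMap.comp_apply, LinearMap.add_apply, LinearMap.sub_apply, LinearMap.id_apply,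
      LinearMap.smul_apply, map_sub] at *
    rw [hh', ht', hr (K x), map_smul, smul_smul, hc, one_smul]
    simp
  exact comp_right_cancel_of_isUnit hu e

end Perturbation

/-! ### Higher homotopies on split tensor powers -/

section Split

variable {k : Type*} [CommRing k]
variable {A : Type*} [AddCommGroup A] [Module k A]
variable {𝒜 : ℤ → Submodule k A} [DirectSum.Decomposition 𝒜] {p q : ℕ}

/-- The operator `1 ⊗ ψ` for odd `ψ` carries the sign operator on its left block, and that alone
produces the minus sign; `ψ` itself plays no role. -/
theorem tmap_anticomm {φ : ⨂[k]^p A →ₗ[k] ⨂[k]^p A} {c : ℤ}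
    (hφ : IsHomog (tensorGr 𝒜 p) (tensorGr 𝒜 p) c φ) (hc : Odd c)
    (ψ : ⨂[k]^q A →ₗ[k] ⨂[k]^q A) :
    tmap φ LinearMap.id ∘ₗ tmap (tensorPow (sgn 𝒜 1) p) ψ =
      -(tmap (tensorPow (sgn 𝒜 1) p) ψ ∘ₗ tmap φ LinearMap.id) := by
  rw [tmap_comp, tmap_comp, tensorPow_sgn_comp_of_odd hφ (by simpa using hc), tmap_neg_left,
    neg_neg, LinearMap.id_comp, LinearMap.comp_id]

theorem derExt_split (φ : A →ₗ[k] A) :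
    derExt 𝒜 (-1) φ (p + q) = tmap (derExt 𝒜 (-1) φ p) LinearMap.id +
      tmap (tensorPow (sgn 𝒜 1) p) (derExt 𝒜 (-1) φ q) := by
  rw [derExt_add_index, sgn_neg]

theorem tensorHom_one_eq (φ : ⨂[k]^p A →ₗ[k] ⨂[k]^p A) (ψ : ⨂[k]^q A →ₗ[k] ⨂[k]^q A) :
    tensorHom 𝒜 1 φ ψ =
      tmap φ LinearMap.id ∘ₗ tmap (tensorPow (sgn 𝒜 1) p) ψ := by
  rw [tensorHom_eq, tmap_comp, LinearMap.id_comp]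

theorem tensorHom_one_id (ψ : ⨂[k]^q A →ₗ[k] ⨂[k]^q A) :
    tensorHom 𝒜 1 (LinearMap.id : ⨂[k]^p A →ₗ[k] _) ψ = tmap (tensorPow (sgn 𝒜 1) p) ψ := by
  rw [tensorHom_eq, LinearMap.id_comp]

end Split

section Operadic

variable {k : Type*} [CommRing k] {O : Operad k}
variable {A : Type*} [AddCommGroup A] [Module k A]
variable {B : Type*} [AddCommGroup B] [Module k B]
variable {𝒜 : ℤ → Submodule k A} [DirectSum.Decomposition 𝒜]
variable {ℬ : ℤ → Submodule k B} [DirectSum.Decomposition ℬ]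
variable {dA : A →ₗ[k] A} {dB : B →ₗ[k] B}
variable {γA : ∀ n, O.obj n →ₗ[k] (⨂[k]^n A →ₗ[k] A)}
variable {γB : ∀ n, O.obj n →ₗ[k] (⨂[k]^n B →ₗ[k] B)}

theorem Operad.hom_ext {n : ℕ} {X : Type*} [AddCommGroup X] [Module k X] {φ ψ : O.obj n →ₗ[k] X}
    (H : ∀ a, ∀ μ ∈ O.gr n a, φ μ = ψ μ) : φ = ψ := by
  have : ⊤ ≤ LinearMap.eqLocus φ ψ := by
    rw [← (O.internal n).submodule_iSup_eq_top]
    exact iSup_le fun a μ hμ => H a μ hμ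
  exact LinearMap.ext fun μ => this trivial

theorem IsOpAlgebra.perturb {d t : A →ₗ[k] A} (hA : IsOpAlgebra O 𝒜 d γA)
    (ht : IsPerturbation 𝒜 d t) (hder : IsOpDerivation O 𝒜 γA (-1) t) :
    IsOpAlgebra O 𝒜 (d + t) γA where
  isDifferential := ⟨hA.isDifferential.deg.add ht.deg, ht.sq⟩
  deg := hA.deg
  diff n a μ hμ := by
    have e := hder.map n a μ hμ
    rw [mul_neg_one, ksign_neg] at e
    rw [hA.diff n a μ hμ, derExt_add, LinearMap.add_comp, e, LinearMap.comp_add, smul_add]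
    abel
  one := hA.one
  comp := hA.comp
  act := hA.act

theorem tensorPow_zero_one : tensorPow (0 : A →ₗ[k] B) 1 = 0 :=
  PiTensorProduct.ext (MultilinearMap.ext fun _ =>
    (tensorPow_tprod _ _ _).trans (MultilinearMap.map_coord_zero _ 0 rfl))

variable {f : A →ₗ[k] B} {g : B →ₗ[k] A} {h : A →ₗ[k] A}
variable {hn : ∀ n, ⨂[k]^n A →ₗ[k] ⨂[k]^n A}

namespace IsOpContractionVia

variable (C : IsOpContractionVia O 𝒜 ℬ dA dB γA γB f g h hn)
include C

theorem split_left {p q : ℕ} (hp : 1 ≤ p) (hq : 1 ≤ q) :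
    (tmap (hn p) LinearMap.id - tmap (tensorPow (sgn 𝒜 1) p) (hn q)) ∘ₗ hn (p + q) =
      tmap (hn p) LinearMap.id ∘ₗ tmap (tensorPow (sgn 𝒜 1) p) (hn q) := by
  rw [← tensorHom_one_eq, ← C.pseudo_left p q hp hq, tensorHom_zero_id, tensorHom_one_id]

theorem split_right {p q : ℕ} (hp : 1 ≤ p) (hq : 1 ≤ q) :
    hn (p + q) ∘ₗ (tmap (hn p) LinearMap.id - tmap (tensorPow (sgn 𝒜 1) p) (hn q)) =
      -(tmap (hn p) LinearMap.id ∘ₗ tmap (tensorPow (sgn 𝒜 1) p) (hn q)) := by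
  rw [← tensorHom_one_eq, ← C.pseudo_right p q hp hq, tensorHom_zero_id, tensorHom_one_id, neg_neg]

theorem split_homotopy_left {p : ℕ} (q : ℕ) (hp : 1 ≤ p) :
    tmap (derExt 𝒜 (-1) dA p) LinearMap.id ∘ₗ tmap (hn p) LinearMap.id +
      tmap (hn p) LinearMap.id ∘ₗ tmap (derExt 𝒜 (-1) dA p) LinearMap.id =
    tmap (tensorPow (g ∘ₗ f) p) (LinearMap.id : ⨂[k]^q A →ₗ[k] _) - LinearMap.id := by
  rw [tmap_comp, tmap_comp, LinearMap.id_comp, ← tmap_add_left, (C.contraction p hp).homotopy,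
    tmap_sub_left, tmap_id, tensorPow_comp]

theorem split_homotopy_right (p : ℕ) {q : ℕ} (hq : 1 ≤ q) :
    tmap (tensorPow (sgn 𝒜 1) p) (derExt 𝒜 (-1) dA q) ∘ₗ
        tmap (tensorPow (sgn 𝒜 1) p) (hn q) +
      tmap (tensorPow (sgn 𝒜 1) p) (hn q) ∘ₗ
        tmap (tensorPow (sgn 𝒜 1) p) (derExt 𝒜 (-1) dA q) =
    tmap (LinearMap.id : ⨂[k]^p A →ₗ[k] _) (tensorPow (g ∘ₗ f) q) - LinearMap.id := by
  rw [tmap_comp, tmap_comp, tensorPow_sgn_comp_self, ← tmap_add_right,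
    (C.contraction q hq).homotopy, tmap_sub_right, tmap_id, tensorPow_comp]

theorem sgn_comp_gf : sgn 𝒜 1 ∘ₗ (g ∘ₗ f) = (g ∘ₗ f) ∘ₗ sgn 𝒜 1 := by
  rw [sgn_comp 𝒜 𝒜 (C.base.g_deg.comp C.base.f_deg rfl), zero_add, zero_mul, ksign_zero, one_smul]

/-- The higher homotopies annihilate the tensor powers of every map annihilated by `h`. -/
theorem hn_comp_tensorPow {φ : A →ₗ[k] A} (hφ : h ∘ₗ φ = 0) (n : ℕ) (h_n : 1 ≤ n) :
    hn n ∘ₗ tensorPow φ n = 0 := by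
  induction n, h_n using Nat.le_induction with
  | base => rw [C.hn_one, ← tensorPow_comp, hφ, tensorPow_zero_one]
  | succ n h_n ih =>
    have e1 : hn 1 ∘ₗ tensorPow φ 1 = 0 := by
      rw [C.hn_one, ← tensorPow_comp, hφ, tensorPow_zero_one]
    have hD := derExt_homog C.algA.isDifferential.deg n
    have hH := (C.contraction n h_n).h_deg
    have one_odd : Odd (1 : ℤ) := by decide
    -- Applied to the splitting `n + 1` with `z = φ^{⊗(n+1)}`: the induction hypothesis says that
    -- `h_n ⊗ 1` kills `z`, the case of one factor that `1 ⊗ h_1` does.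
    refine mul_eq_zero_of_split (R := Module.End k (⨂[k]^(n + 1) A))
      (tmap_anticomm (q := 1) hH one_odd (hn 1))
      (tmap_anticomm hD (by decide) _)
      (tmap_anticomm (q := 1) hH one_odd (derExt 𝒜 (-1) dA 1))
      (C.split_homotopy_left 1 h_n) (C.split_homotopy_right n le_rfl) ?_ ?_ ?_ ?_
      (C.split_right h_n le_rfl) ?_ ?_ <;> simp only [Module.End.mul_eq_comp]
    · rw [tmap_comp, tmap_comp, ← tensorPow_comp, ← tensorPow_comp, C.sgn_comp_gf,
        LinearMap.id_comp, LinearMap.comp_id]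
    · rw [tmap_comp, tensorPow_comp, ← LinearMap.comp_assoc, (C.contraction n h_n).h_g,
        LinearMap.zero_comp, tmap_zero_left]
    · rw [tmap_comp, tmap_comp]
      simp only [LinearMap.id_comp, LinearMap.comp_id]
    · rw [tmap_comp, LinearMap.id_comp, LinearMap.comp_id, ← tensorPow_add, tensorPow_comp,
        ← LinearMap.comp_assoc, (C.contraction (n + 1) (by omega)).h_g, LinearMap.zero_comp]
    · rw [tensorPow_add, tmap_comp, ih, tmap_zero_left]
    · rw [tensorPow_add, tmap_comp, e1, tmap_zero_right]

/-- The tensor powers of every map that annihilates `h` annihilate the higher homotopies. -/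
theorem tensorPow_comp_hn {φ : A →ₗ[k] A} (hφ : φ ∘ₗ h = 0) (n : ℕ) (h_n : 1 ≤ n) :
    tensorPow φ n ∘ₗ hn n = 0 := by
  induction n, h_n using Nat.le_induction with
  | base => rw [C.hn_one, ← tensorPow_comp, hφ, tensorPow_zero_one]
  | succ n h_n ih =>
    have e1 : tensorPow φ 1 ∘ₗ hn 1 = 0 := by
      rw [C.hn_one, ← tensorPow_comp, hφ, tensorPow_zero_one]
    have hD := derExt_homog C.algA.isDifferential.deg n
    have hH := (C.contraction n h_n).h_deg
    have one_odd : Odd (1 : ℤ) := by decide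
    refine mul_eq_zero_of_split' (R := Module.End k (⨂[k]^(n + 1) A))
      (tmap_anticomm (q := 1) hH one_odd (hn 1))
      (tmap_anticomm hD (by decide) _)
      (tmap_anticomm (q := 1) hH one_odd (derExt 𝒜 (-1) dA 1))
      (C.split_homotopy_left 1 h_n) (C.split_homotopy_right n le_rfl) ?_ ?_ ?_ ?_
      (C.split_left h_n le_rfl) ?_ ?_ <;> simp only [Module.End.mul_eq_comp]
    · rw [tmap_comp, tmap_comp, ← tensorPow_comp, ← tensorPow_comp, C.sgn_comp_gf,
        LinearMap.id_comp, LinearMap.comp_id]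
    · rw [tmap_comp, tensorPow_comp, LinearMap.comp_assoc, (C.contraction n h_n).f_h,
        LinearMap.comp_zero, tmap_zero_left]
    · rw [tmap_comp, tmap_comp]
      simp only [LinearMap.id_comp, LinearMap.comp_id]
    · rw [tmap_comp, LinearMap.id_comp, LinearMap.comp_id, ← tensorPow_add, tensorPow_comp,
        LinearMap.comp_assoc, (C.contraction (n + 1) (by omega)).f_h, LinearMap.comp_zero]
    · rw [tensorPow_add, tmap_comp, ih, tmap_zero_left]
    · rw [tensorPow_add, tmap_comp, e1, tmap_zero_right]

end IsOpContractionVia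

end Operadic

/-! ### Koszul signs of permutations -/

section KoszulSign

variable {n : ℕ}

/-- The sign produced when a map of odd degree moves past the first `i` factors of a tensor whose
factors have parities `e`. -/
def leftSign (e : Fin n → Bool) (i : Fin n) : ℤ := ∏ j, if j < i ∧ e j = true then -1 else 1

theorem ite_mul_self (P : Prop) [Decidable P] :
    (if P then -1 else 1 : ℤ) * (if P then -1 else 1) = 1 := by split_ifs <;> rfl

theorem leftSign_mul_self (e : Fin n → Bool) (i : Fin n) : leftSign e i * leftSign e i = 1 := by
  rw [leftSign, ← Finset.prod_mul_distrib]
  exact Finset.prod_eq_one fun j _ => ite_mul_self _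

theorem koszulSign_mul_self (σ : Equiv.Perm (Fin n)) (e : Fin n → Bool) :
    koszulSign σ e * koszulSign σ e = 1 := by
  rw [koszulSign, ← Finset.prod_mul_distrib]
  refine Finset.prod_eq_one fun i _ => ?_
  rw [← Finset.prod_mul_distrib]
  exact Finset.prod_eq_one fun j _ => ite_mul_self _

theorem leftSign_comp_symm (σ : Equiv.Perm (Fin n)) (e : Fin n → Bool) (i : Fin n) :
    leftSign (fun j => e (σ.symm j)) (σ i) = ∏ j, if σ j < σ i ∧ e j = true then -1 else 1 := by
  rw [leftSign, ← Equiv.prod_comp σ]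
  simp only [Equiv.symm_apply_apply]

/-- The effect on the Koszul sign of a permutation of changing the parity of one factor. -/
theorem koszulSign_update (σ : Equiv.Perm (Fin n)) (e : Fin n → Bool) (i : Fin n) :
    koszulSign σ (Function.update e i (!e i)) * koszulSign σ e =
      leftSign e i * leftSign (fun j => e (σ.symm j)) (σ i) := by
  -- In the product of the two signs, pairs avoiding `i` contribute squares. In a pair containing
  -- `i`, that factor is odd for exactly one of the two parity patterns, so the parity of the other
  -- factor decides.
  have H : ∀ a b, (if a < b ∧ σ b < σ a ∧ Function.update e i (!e i) a = true ∧
        Function.update e i (!e i) b = true then -1 else 1 : ℤ) *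
      (if a < b ∧ σ b < σ a ∧ e a = true ∧ e b = true then -1 else 1) =
      (if a = i then (if i < b ∧ σ b < σ i ∧ e b = true then -1 else 1) else 1) *
        (if b = i then (if a < i ∧ σ i < σ a ∧ e a = true then -1 else 1) else 1) := by
    intro a b
    rcases eq_or_ne a i with rfl | ha
    · rcases eq_or_ne b a with rfl | hb
      · simp
      · rw [Function.update_self, Function.update_of_ne hb, if_pos rfl, if_neg hb, mul_one]
        cases e a <;> simp
    · rw [Function.update_of_ne ha, if_neg ha, one_mul]
      rcases eq_or_ne b i with rfl | hb
      · rw [Function.update_self, if_pos rfl]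
        cases e b <;> simp
      · rw [Function.update_of_ne hb, if_neg hb, ite_mul_self]
  rw [leftSign_comp_symm, leftSign, koszulSign, koszulSign, ← Finset.prod_mul_distrib,
    ← Finset.prod_mul_distrib]
  simp only [← Finset.prod_mul_distrib, H]
  simp only [Finset.prod_mul_distrib, Finset.prod_ite_eq', Finset.mem_univ, if_true]
  rw [Finset.prod_comm]
  simp only [Finset.prod_ite_eq', Finset.mem_univ, if_true]
  rw [← Finset.prod_mul_distrib, ← Finset.prod_mul_distrib]
  refine Finset.prod_congr rfl fun j _ => ?_
  -- The pair of `i` and `j` is inverted exactly when one, but not both, of `j < i` and `σ j < σ i`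
  -- holds.
  rcases lt_trichotomy j i with hj | rfl | hj
  · rcases lt_trichotomy (σ j) (σ i) with h | h | h
    · cases e j <;> simp [hj, hj.not_gt, h, h.not_gt]
    · exact absurd (σ.injective h) hj.ne
    · simp [hj, hj.not_gt, h, h.not_gt]
  · simp
  · rcases lt_trichotomy (σ j) (σ i) with h | h | h
    · simp [hj, hj.not_gt, h]
    · exact absurd (σ.injective h) hj.ne'
    · simp [hj, hj.not_gt, h.not_gt]

theorem leftSign_mul_koszulSign (σ : Equiv.Perm (Fin n)) (e : Fin n → Bool) (i : Fin n) :
    leftSign e i * koszulSign σ (Function.update e i (!e i)) =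
      koszulSign σ e * leftSign (fun j => e (σ.symm j)) (σ i) := by
  linear_combination leftSign e i * koszulSign σ e * koszulSign_update σ e i -
    leftSign e i * koszulSign σ (Function.update e i (!e i)) * koszulSign_mul_self σ e +
    koszulSign σ e * leftSign (fun j => e (σ.symm j)) (σ i) * leftSign_mul_self e i

end KoszulSign

section KoszulPerm

variable {k : Type*} [CommRing k]
variable {A : Type*} [AddCommGroup A] [Module k A]
variable {𝒜 : ℤ → Submodule k A} [DirectSum.Decomposition 𝒜] {n : ℕ}

/-- On a homogeneous tensor only the parity pattern of its own degrees survives in the sum. -/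
theorem koszulPerm_tprod (σ : Equiv.Perm (Fin n)) {a : Fin n → ℤ} {x : Fin n → A}
    (hx : ∀ i, x i ∈ 𝒜 (a i)) :
    koszulPerm 𝒜 σ (PiTensorProduct.tprod k x) =
      (koszulSign σ (fun i => decide (Odd (a i))) : k) •
        PiTensorProduct.tprod k (fun i => x (σ.symm i)) := by
  rw [koszulPerm, LinearMap.sum_apply,
    Finset.sum_eq_single_of_mem (fun i => decide (Odd (a i))) (Finset.mem_univ _)]
  · rw [LinearMap.smul_apply, LinearMap.comp_apply, PiTensorProduct.map_tprod,
      LinearEquiv.coe_coe]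
    simp only [fun i => parityProj_apply_of_mem 𝒜 (decide (Odd (a i))) (hx i), if_true]
    rw [PiTensorProduct.reindex_tprod]
  · intro e _ he
    obtain ⟨i, hi⟩ := Function.ne_iff.1 he
    rw [LinearMap.smul_apply, LinearMap.comp_apply, PiTensorProduct.map_tprod,
      MultilinearMap.map_coord_zero _ i, map_zero, smul_zero]
    rw [parityProj_apply_of_mem 𝒜 _ (hx i), if_neg (Ne.symm hi)]

theorem derExt_tprod_of_mem {b : ℤ} (hb : Odd b) (φ : A →ₗ[k] A) {a : Fin n → ℤ} {x : Fin n → A}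
    (hx : ∀ i, x i ∈ 𝒜 (a i)) :
    derExt 𝒜 b φ n (PiTensorProduct.tprod k x) =
      ∑ i, (leftSign (fun i => decide (Odd (a i))) i : k) •
        PiTensorProduct.tprod k (Function.update x i (φ (x i))) := by
  rw [derExt_tprod]
  refine Finset.sum_congr rfl fun i _ => ?_
  rw [leftSign, Int.cast_prod, ← MultilinearMap.map_smul_univ]
  congr 1
  funext j
  rcases eq_or_ne j i with rfl | hj
  · simp
  · rw [Function.update_of_ne hj, Function.update_of_ne hj, sgn_apply_of_mem 𝒜 b (hx j)]
    by_cases hji : j < i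
    · by_cases ho : Odd (a j)
      · simp [hji, ho, ksign, Int.negOnePow_odd _ (ho.mul hb)]
      · simp [hji, ho, ksign, Int.negOnePow_even _ ((Int.not_odd_iff_even.1 ho).mul_right b)]
    · simp [hji]

/-- Applying `φ` in slot `i` and then permuting matches permuting and then applying `φ` in slot `σ
i`. As `φ` is odd it flips one parity, and `leftSign_mul_koszulSign` compares the signs. -/
theorem koszulPerm_comp_derExt {b : ℤ} (hb : Odd b) {φ : A →ₗ[k] A} (hφ : IsHomog 𝒜 𝒜 b φ)
    (σ : Equiv.Perm (Fin n)) :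
    koszulPerm 𝒜 σ ∘ₗ derExt 𝒜 b φ n = derExt 𝒜 b φ n ∘ₗ koszulPerm 𝒜 σ := by
  refine tensor_ext_of_homogeneous (𝒜 := 𝒜) fun a x hx => ?_
  rw [LinearMap.comp_apply, LinearMap.comp_apply, derExt_tprod_of_mem hb φ hx,
    koszulPerm_tprod σ hx, map_smul, derExt_tprod_of_mem hb φ (fun i => hx (σ.symm i)),
    map_sum, Finset.smul_sum]
  refine Finset.sum_equiv σ (by simp) fun i _ => ?_
  have hy : ∀ j, Function.update x i (φ (x i)) j ∈ 𝒜 (Function.update a i (a i + b) j) := by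
    intro j
    rcases eq_or_ne j i with rfl | hj
    · simpa using hφ _ _ (hx j)
    · simpa [Function.update_of_ne hj] using hx j
  have he : (fun j => decide (Odd (Function.update a i (a i + b) j))) =
      Function.update (fun j => decide (Odd (a j))) i (!decide (Odd (a i))) := by
    funext j
    rcases eq_or_ne j i with rfl | hj
    · rw [Function.update_self, Function.update_self, ← decide_not, decide_eq_decide,
        Int.odd_add, Int.not_odd_iff_even, ← Int.not_odd_iff_even, ← Int.not_odd_iff_even]
      tauto
    · simp [Function.update_of_ne hj]
  have hz : (fun j => Function.update x i (φ (x i)) (σ.symm j)) =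
      Function.update (fun j => x (σ.symm j)) (σ i) (φ (x (σ.symm (σ i)))) := by
    funext j
    rcases eq_or_ne j (σ i) with rfl | hj
    · simp
    · rw [Function.update_of_ne hj, Function.update_of_ne]
      rintro rfl
      simp at hj
  rw [map_smul, koszulPerm_tprod σ hy, he, hz, smul_smul, smul_smul, ← Int.cast_mul,
    ← Int.cast_mul, leftSign_mul_koszulSign σ (fun j => decide (Odd (a j))) i]

end KoszulPerm

/-! ### Perturbation of contractions of algebras over an operad -/

section Operadic

variable {k : Type*} [CommRing k] {O : Operad k}
variable {A : Type*} [AddCommGroup A] [Module k A]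
variable {B : Type*} [AddCommGroup B] [Module k B]
variable {𝒜 : ℤ → Submodule k A} [DirectSum.Decomposition 𝒜]
variable {ℬ : ℤ → Submodule k B} [DirectSum.Decomposition ℬ]
variable {dA : A →ₗ[k] A} {dB : B →ₗ[k] B}
variable {γA : ∀ n, O.obj n →ₗ[k] (⨂[k]^n A →ₗ[k] A)}
variable {γB : ∀ n, O.obj n →ₗ[k] (⨂[k]^n B →ₗ[k] B)}
variable {FA : ℤ → Submodule k A} {FB : ℤ → Submodule k B}
variable {f : A →ₗ[k] B} {g : B →ₗ[k] A} {h t : A →ₗ[k] A}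
variable {hn : ∀ n, ⨂[k]^n A →ₗ[k] ⨂[k]^n A}

theorem derExt_isPerturbation {d t : A →ₗ[k] A} (hd : IsDifferential 𝒜 d)
    (ht : IsPerturbation 𝒜 d t) (n : ℕ) :
    IsPerturbation (tensorGr 𝒜 n) (derExt 𝒜 (-1) d n) (derExt 𝒜 (-1) t n) :=
  ⟨derExt_homog ht.deg n, by
    rw [← derExt_add]
    exact derExt_comp_self (hd.deg.add ht.deg) ht.sq n⟩

variable (𝒜 hn t) in
/-- The higher homotopies of the perturbed contraction. -/
noncomputable def perturbHn (n : ℕ) : ⨂[k]^n A →ₗ[k] ⨂[k]^n A :=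
  hn n + hn n ∘ₗ pertSeries (hn n) (derExt 𝒜 (-1) t n) ∘ₗ hn n

/-- The perturbation of the contraction of `A^{⊗n}` is the contraction given by the tensor powers
of the perturbed maps. -/
theorem IsOpContractionVia.perturb_tensor
    (hb : IsFilteredContraction 𝒜 ℬ dA dB FA FB f g h)
    (C : IsOpContractionVia O 𝒜 ℬ dA dB γA γB f g h hn)
    (hf : ∀ n, 1 ≤ n → IsFilteredContraction (tensorGr 𝒜 n) (tensorGr ℬ n) (derExt 𝒜 (-1) dA n)
      (derExt ℬ (-1) dB n) (tensorFil FA n) (tensorFil FB n) (tensorPow f n) (tensorPow g n) (hn n))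
    (ht : IsPerturbation 𝒜 dA t) (htF : ∀ p, ∀ x ∈ FA p, t x ∈ FA (p - 1))
    {n : ℕ} (h_n : 1 ≤ n) :
    IsUnit (LinearMap.id - hn n ∘ₗ derExt 𝒜 (-1) t n : Module.End k (⨂[k]^n A)) ∧
    tensorPow (f + f ∘ₗ pertSeries h t ∘ₗ h) n =
      tensorPow f n + tensorPow f n ∘ₗ pertSeries (hn n) (derExt 𝒜 (-1) t n) ∘ₗ hn n ∧
    tensorPow (g + h ∘ₗ pertSeries h t ∘ₗ g) n =
      tensorPow g n + hn n ∘ₗ pertSeries (hn n) (derExt 𝒜 (-1) t n) ∘ₗ tensorPow g n ∧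
    derExt ℬ (-1) (f ∘ₗ pertSeries h t ∘ₗ g) n =
      tensorPow f n ∘ₗ pertSeries (hn n) (derExt 𝒜 (-1) t n) ∘ₗ tensorPow g n ∧
    IsFilteredContraction (tensorGr 𝒜 n) (tensorGr ℬ n) (derExt 𝒜 (-1) (dA + t) n)
      (derExt ℬ (-1) (dB + f ∘ₗ pertSeries h t ∘ₗ g) n) (tensorFil FA n) (tensorFil FB n)
      (tensorPow (f + f ∘ₗ pertSeries h t ∘ₗ h) n) (tensorPow (g + h ∘ₗ pertSeries h t ∘ₗ g) n)
      (perturbHn 𝒜 t hn n) := by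
  have hT := derExt_isPerturbation C.algA.isDifferential ht n
  have hTF := derExt_lowers hb.filM.graded htF n (b := -1)
  have hu := isUnit_id_sub ((hf n h_n).perturb_lowers hTF)
  have P := (hf n h_n).perturb hT hTF
  have P₁ := (hb.perturb ht htF).contraction
  have Cn := C.contraction n h_n
  have cg : h ∘ₗ (g + h ∘ₗ pertSeries h t ∘ₗ g) = 0 := by
    rw [LinearMap.comp_add, C.base.h_g, ← LinearMap.comp_assoc, C.base.h_h]
    simp
  have fg : f ∘ₗ (g + h ∘ₗ pertSeries h t ∘ₗ g) = LinearMap.id := by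
    rw [LinearMap.comp_add, C.base.f_g, ← LinearMap.comp_assoc, C.base.f_h]
    simp
  have cf : (f + f ∘ₗ pertSeries h t ∘ₗ h) ∘ₗ h = 0 := by
    rw [LinearMap.add_comp, C.base.f_h, LinearMap.comp_assoc, LinearMap.comp_assoc, C.base.h_h]
    simp
  have gf : (f + f ∘ₗ pertSeries h t ∘ₗ h) ∘ₗ g = LinearMap.id := by
    rw [LinearMap.add_comp, C.base.f_g, LinearMap.comp_assoc, LinearMap.comp_assoc, C.base.h_g]
    simp
  have e1 : tensorPow (g + h ∘ₗ pertSeries h t ∘ₗ g) n =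
      tensorPow g n + hn n ∘ₗ pertSeries (hn n) (derExt 𝒜 (-1) t n) ∘ₗ tensorPow g n := by
    refine Cn.eq_perturb_g hu ?_ ?_ ?_ (d' := derExt ℬ (-1) (dB + f ∘ₗ pertSeries h t ∘ₗ g) n)
    -- `hn_comp_tensorPow` concerns endomorphisms of `A`, so it is applied to `g' f`; composing with
    -- `g^{⊗n}` then removes `f^{⊗n}`.
    · have := C.hn_comp_tensorPow (φ := (g + h ∘ₗ pertSeries h t ∘ₗ g) ∘ₗ f)
        (by rw [← LinearMap.comp_assoc, cg, LinearMap.zero_comp]) n h_n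
      rw [tensorPow_comp] at this
      have := congrArg (fun φ => φ ∘ₗ tensorPow g n) this
      simpa only [LinearMap.comp_assoc, Cn.f_g, LinearMap.comp_id, LinearMap.zero_comp] using this
    · rw [← tensorPow_comp, fg, tensorPow_id]
    · rw [← derExt_add]
      exact derExt_comp_tensorPow P₁.g_deg P₁.g_chain n
  have e2 : tensorPow (f + f ∘ₗ pertSeries h t ∘ₗ h) n =
      tensorPow f n + tensorPow f n ∘ₗ pertSeries (hn n) (derExt 𝒜 (-1) t n) ∘ₗ hn n := by
    refine Cn.eq_perturb_f hu ?_ ?_ ?_ (d' := derExt ℬ (-1) (dB + f ∘ₗ pertSeries h t ∘ₗ g) n)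
    · have := C.tensorPow_comp_hn (φ := g ∘ₗ (f + f ∘ₗ pertSeries h t ∘ₗ h))
        (by rw [LinearMap.comp_assoc, cf, LinearMap.comp_zero]) n h_n
      rw [tensorPow_comp] at this
      have := congrArg (fun φ => tensorPow f n ∘ₗ φ) this
      simpa only [← LinearMap.comp_assoc, Cn.f_g, LinearMap.id_comp, LinearMap.comp_zero] using this
    · rw [← tensorPow_comp, gf, tensorPow_id]
    · rw [← derExt_add]
      exact derExt_comp_tensorPow P₁.f_deg P₁.f_chain n
  have e3 : derExt ℬ (-1) (f ∘ₗ pertSeries h t ∘ₗ g) n =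
      tensorPow f n ∘ₗ pertSeries (hn n) (derExt 𝒜 (-1) t n) ∘ₗ tensorPow g n := by
    -- Two differentials on `B^{⊗n}` make `g'^{⊗n}` a chain map. They agree because `g'^{⊗n}` has
    -- the left inverse `f'^{⊗n}`.
    have c1 := P.contraction.g_chain
    have c2 := derExt_comp_tensorPow (b := -1) P₁.g_deg P₁.g_chain n
    rw [← e1, ← derExt_add, c2] at c1
    have c3 : tensorPow (f + f ∘ₗ pertSeries h t ∘ₗ h) n ∘ₗ
        tensorPow (g + h ∘ₗ pertSeries h t ∘ₗ g) n = LinearMap.id := by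
      rw [← tensorPow_comp, P₁.f_g, tensorPow_id]
    have inj : Function.Injective (tensorPow (g + h ∘ₗ pertSeries h t ∘ₗ g) n) :=
      Function.LeftInverse.injective (LinearMap.congr_fun c3)
    refine add_left_cancel (a := derExt ℬ (-1) dB n) ?_
    rw [← derExt_add]
    exact LinearMap.ext fun z => inj (LinearMap.congr_fun c1 z)
  refine ⟨hu, e2, e1, e3, ?_⟩
  rw [e1, e2, derExt_add, derExt_add, e3]
  exact P

theorem IsOpDerivation.comp_nullary (hder : IsOpDerivation O 𝒜 γA (-1) t) (μ : O.obj 0) :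
    t ∘ₗ γA 0 μ = 0 := by
  have : (LinearMap.llcomp k (⨂[k]^0 A) A A t) ∘ₗ γA 0 = 0 := by
    refine O.hom_ext fun a μ hμ => ?_
    have e := hder.map 0 a μ hμ
    rw [derExt_zero, LinearMap.comp_zero, smul_zero] at e
    exact e
  exact LinearMap.congr_fun this μ

namespace IsOpContractionVia

variable (C : IsOpContractionVia O 𝒜 ℬ dA dB γA γB f g h hn)
include C

/-- Nullary operations of `A` are the images under `g` of those of `B`, and `h g = 0`. Arity `0`
needs this separate argument because the higher homotopies are constrained only for `n ≥ 1`. -/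
theorem h_comp_nullary (μ : O.obj 0) : h ∘ₗ γA 0 μ = 0 := by
  have e := C.morg.map 0 μ
  refine PiTensorProduct.ext (MultilinearMap.ext fun x => ?_)
  have e' := LinearMap.congr_fun e (PiTensorProduct.tprod k fun i => f (x i))
  rw [LinearMap.comp_apply, LinearMap.comp_apply, tensorPow_tprod] at e'
  simp only [LinearMap.compMultilinearMap_apply, LinearMap.comp_apply]
  rw [show x = fun i => g (f (x i)) from funext fun i => i.elim0, ← e']
  exact LinearMap.congr_fun C.base.h_g _

/-- The perturbed higher homotopies inherit the compatibility with splittings. -/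
theorem perturb_split {p q : ℕ}
    (hup : IsUnit (LinearMap.id - hn p ∘ₗ derExt 𝒜 (-1) t p : Module.End k (⨂[k]^p A)))
    (huq : IsUnit (LinearMap.id - hn q ∘ₗ derExt 𝒜 (-1) t q : Module.End k (⨂[k]^q A)))
    (hu : IsUnit (LinearMap.id - hn (p + q) ∘ₗ derExt 𝒜 (-1) t (p + q) :
      Module.End k (⨂[k]^(p + q) A)))
    (ht : IsHomog 𝒜 𝒜 (-1) t)
    (hdeg : IsHomog (tensorGr 𝒜 p) (tensorGr 𝒜 p) 1 (perturbHn 𝒜 t hn p))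
    (hp : 1 ≤ p) (hq : 1 ≤ q) :
    (tmap (perturbHn 𝒜 t hn p) LinearMap.id -
        tmap (tensorPow (sgn 𝒜 1) p) (perturbHn 𝒜 t hn q)) ∘ₗ perturbHn 𝒜 t hn (p + q) =
      tmap (perturbHn 𝒜 t hn p) LinearMap.id ∘ₗ
        tmap (tensorPow (sgn 𝒜 1) p) (perturbHn 𝒜 t hn q) ∧
    -(perturbHn 𝒜 t hn (p + q) ∘ₗ (tmap (perturbHn 𝒜 t hn p) LinearMap.id -
        tmap (tensorPow (sgn 𝒜 1) p) (perturbHn 𝒜 t hn q))) =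
      tmap (perturbHn 𝒜 t hn p) LinearMap.id ∘ₗ
        tmap (tensorPow (sgn 𝒜 1) p) (perturbHn 𝒜 t hn q) := by
  have hT := derExt_homog ht p
  have hH := (C.contraction p hp).h_deg
  have one_odd : Odd (1 : ℤ) := by decide
  have neg_odd : Odd (-1 : ℤ) := by decide
  have r1 := tmap_anticomm hH one_odd (hn q)
  have r2 := tmap_anticomm hT neg_odd (hn q)
  have r3 := tmap_anticomm hH one_odd (derExt 𝒜 (-1) t q)
  have r4 := tmap_anticomm hT neg_odd (derExt 𝒜 (-1) t q)
  have rT := derExt_split (𝒜 := 𝒜) (p := p) (q := q) t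
  -- Of three sign operators on the left block two cancel, so the recursions for the perturbed `h_q`
  -- carry over to `1 ⊗ h_q` unchanged.
  have triple : ∀ X Y Z : ⨂[k]^q A →ₗ[k] ⨂[k]^q A,
      (tmap (tensorPow (sgn 𝒜 1) p) X ∘ₗ tmap (tensorPow (sgn 𝒜 1) p) Y) ∘ₗ
        tmap (tensorPow (sgn 𝒜 1) p) Z = tmap (tensorPow (sgn 𝒜 1) p) ((X ∘ₗ Y) ∘ₗ Z) := by
    intro X Y Z
    rw [tmap_comp, tmap_comp, tensorPow_sgn_comp_self, LinearMap.id_comp]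
  have triple' : ∀ X Y Z : ⨂[k]^p A →ₗ[k] ⨂[k]^p A,
      (tmap X LinearMap.id ∘ₗ tmap Y LinearMap.id) ∘ₗ
        tmap Z (LinearMap.id : ⨂[k]^q A →ₗ[k] _) = tmap ((X ∘ₗ Y) ∘ₗ Z) LinearMap.id := by
    intro X Y Z
    rw [tmap_comp, tmap_comp, LinearMap.id_comp, LinearMap.id_comp]
  have a1 := (congrArg (fun φ => tmap φ (LinearMap.id : ⨂[k]^q A →ₗ[k] _))
    (perturb_h_left hup)).trans ((tmap_add_left _ _ _).trans (congrArg _ (triple' _ _ _).symm))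
  have a2 := (congrArg (fun φ => tmap φ (LinearMap.id : ⨂[k]^q A →ₗ[k] _))
    (perturb_h_right hup)).trans ((tmap_add_left _ _ _).trans (congrArg _ (triple' _ _ _).symm))
  have b1 := (congrArg (fun φ => tmap (tensorPow (sgn 𝒜 1) p) φ)
    (perturb_h_left huq)).trans ((tmap_add_right _ _ _).trans (congrArg _ (triple _ _ _).symm))
  have b2 := (congrArg (fun φ => tmap (tensorPow (sgn 𝒜 1) p) φ)
    (perturb_h_right huq)).trans ((tmap_add_right _ _ _).trans (congrArg _ (triple _ _ _).symm))
  refine ⟨mul_eq_mul_of_split (R := Module.End k (⨂[k]^(p + q) A)) r1 r2 r3 r4 rT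
    (C.split_left hp hq) a1 a2 b1 b2 (perturb_h_left hu) (perturb_h_right hu), ?_⟩
  have e := mul_eq_mul_of_split' (R := Module.End k (⨂[k]^(p + q) A)) r1 r2 r3 r4 rT
    (C.split_right hp hq) a1 a2 b1 b2 (perturb_h_left hu) (perturb_h_right hu)
  rw [tmap_anticomm hdeg one_odd]
  exact congrArg Neg.neg e

end IsOpContractionVia

/-- The perturbation theorem for a fixed sequence of higher homotopies. -/
theorem IsOpContractionVia.perturb
    (hb : IsFilteredContraction 𝒜 ℬ dA dB FA FB f g h)
    (C : IsOpContractionVia O 𝒜 ℬ dA dB γA γB f g h hn)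
    (hf : ∀ n, 1 ≤ n → IsFilteredContraction (tensorGr 𝒜 n) (tensorGr ℬ n) (derExt 𝒜 (-1) dA n)
      (derExt ℬ (-1) dB n) (tensorFil FA n) (tensorFil FB n) (tensorPow f n) (tensorPow g n) (hn n))
    (ht : IsPerturbation 𝒜 dA t) (htF : ∀ p, ∀ x ∈ FA p, t x ∈ FA (p - 1))
    (hder : IsOpDerivation O 𝒜 γA (-1) t) :
    IsOpContractionVia O 𝒜 ℬ (dA + t) (dB + f ∘ₗ pertSeries h t ∘ₗ g) γA γB
      (f + f ∘ₗ pertSeries h t ∘ₗ h) (g + h ∘ₗ pertSeries h t ∘ₗ g)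
      (h + h ∘ₗ pertSeries h t ∘ₗ h) (perturbHn 𝒜 t hn) ∧
    IsOpDerivation O ℬ γB (-1) (f ∘ₗ pertSeries h t ∘ₗ g) ∧
    IsPerturbation ℬ dB (f ∘ₗ pertSeries h t ∘ₗ g) := by
  have hu := isUnit_id_sub (hb.perturb_lowers htF)
  have P₁ := (hb.perturb ht htF).contraction
  have hS := IsHomog.pertSeries (hb.perturb_lowers htF) C.base.h_deg ht.deg
  have T := fun n (h_n : 1 ≤ n) => C.perturb_tensor hb hf ht htF h_n
  have hdeg : IsHomog ℬ ℬ (-1) (f ∘ₗ pertSeries h t ∘ₗ g) :=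
    C.base.f_deg.comp (hS.comp C.base.g_deg rfl) rfl
  have hpert : IsPerturbation ℬ dB (f ∘ₗ pertSeries h t ∘ₗ g) := ⟨hdeg, P₁.diffN.sq⟩
  have γh : ∀ n, 1 ≤ n → ∀ a, ∀ μ ∈ O.gr n a, ∀ z,
      γA n μ (hn n z) = ksign k a • h (γA n μ z) := fun n h_n a μ hμ z =>
    LinearMap.congr_fun (C.compat n h_n a μ hμ) z
  have γS : ∀ n, 1 ≤ n → ∀ a, ∀ μ ∈ O.gr n a, ∀ z,
      γA n μ (pertSeries (hn n) (derExt 𝒜 (-1) t n) z) =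
        ksign k a • pertSeries h t (γA n μ z) := by
    intro n h_n a μ hμ z
    refine LinearMap.congr_fun (pertSeries_intertwine (ksign_mul_self k a) (T n h_n).1 hu
      (C.compat n h_n a μ hμ) ?_) z
    have e := hder.map n a μ hμ
    rw [mul_neg_one, ksign_neg] at e
    rw [e, smul_smul, ksign_mul_self, one_smul]
  -- A derivation kills nullary operations, hence so does `S`, by `S = t + S h t`.
  have S0 : ∀ μ : O.obj 0, ∀ z, pertSeries h t (γA 0 μ z) = 0 := by
    intro μ z
    have e := LinearMap.congr_fun (pertSeries_eq_right hu) (γA 0 μ z)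
    have e' := LinearMap.congr_fun (hder.comp_nullary μ) z
    simp only [LinearMap.comp_apply, LinearMap.add_apply, LinearMap.zero_apply] at e e'
    rw [e, e', map_zero, map_zero, add_zero]
  have sq := ksign_mul_self k
  have mf : IsOpMorphism O 𝒜 ℬ (dA + t) (dB + f ∘ₗ pertSeries h t ∘ₗ g) γA γB
      (f + f ∘ₗ pertSeries h t ∘ₗ h) := by
    refine ⟨P₁.f_deg, P₁.f_chain, fun n μ => ?_⟩
    rcases Nat.eq_zero_or_pos n with rfl | h_n
    · have e : tensorPow (f + f ∘ₗ pertSeries h t ∘ₗ h) 0 = tensorPow f 0 := by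
        rw [tensorPow, tensorPow]
        congr 1
        exact funext fun i => i.elim0
      rw [e, ← C.morf.map, LinearMap.add_comp, LinearMap.comp_assoc, LinearMap.comp_assoc,
        C.h_comp_nullary]
      simp
    · have : (LinearMap.llcomp k (⨂[k]^n A) A B (f + f ∘ₗ pertSeries h t ∘ₗ h)) ∘ₗ γA n =
          (LinearMap.lcomp k B (tensorPow (f + f ∘ₗ pertSeries h t ∘ₗ h) n)) ∘ₗ γB n := by
        refine O.hom_ext fun a μ hμ => LinearMap.ext fun z => ?_
        have mf := fun z => LinearMap.congr_fun (C.morf.map n μ) z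
        simp only [LinearMap.comp_apply, LinearMap.llcomp_apply, LinearMap.lcomp_apply,
          (T n h_n).2.1, LinearMap.add_apply, map_add] at mf ⊢
        rw [← mf, ← mf, γS n h_n a μ hμ, γh n h_n a μ hμ, map_smul, map_smul, map_smul, smul_smul,
          sq, one_smul]
      exact LinearMap.congr_fun this μ
  have mg : IsOpMorphism O ℬ 𝒜 (dB + f ∘ₗ pertSeries h t ∘ₗ g) (dA + t) γB γA
      (g + h ∘ₗ pertSeries h t ∘ₗ g) := by
    refine ⟨P₁.g_deg, P₁.g_chain, fun n μ => ?_⟩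
    rcases Nat.eq_zero_or_pos n with rfl | h_n
    · have e : tensorPow (g + h ∘ₗ pertSeries h t ∘ₗ g) 0 = tensorPow g 0 := by
        rw [tensorPow, tensorPow]
        congr 1
        exact funext fun i => i.elim0
      rw [e, ← C.morg.map, LinearMap.add_comp, LinearMap.comp_assoc, LinearMap.comp_assoc,
        C.morg.map]
      ext z
      simp [S0]
    · have : (LinearMap.llcomp k (⨂[k]^n B) B A (g + h ∘ₗ pertSeries h t ∘ₗ g)) ∘ₗ γB n =
          (LinearMap.lcomp k A (tensorPow (g + h ∘ₗ pertSeries h t ∘ₗ g) n)) ∘ₗ γA n := by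
        refine O.hom_ext fun a μ hμ => LinearMap.ext fun z => ?_
        have mg := fun z => LinearMap.congr_fun (C.morg.map n μ) z
        simp only [LinearMap.comp_apply, LinearMap.llcomp_apply, LinearMap.lcomp_apply,
          (T n h_n).2.2.1, LinearMap.add_apply, map_add] at mg ⊢
        rw [mg, γh n h_n a μ hμ, γS n h_n a μ hμ, map_smul, smul_smul, sq, one_smul]
      exact LinearMap.congr_fun this μ
  have dt : IsOpDerivation O ℬ γB (-1) (f ∘ₗ pertSeries h t ∘ₗ g) := by
    refine ⟨hdeg, fun n a μ hμ => ?_⟩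
    rw [mul_neg_one, ksign_neg]
    refine LinearMap.ext fun z => ?_
    have mf := fun z => LinearMap.congr_fun (C.morf.map n μ) z
    have mg := fun z => LinearMap.congr_fun (C.morg.map n μ) z
    rcases Nat.eq_zero_or_pos n with rfl | h_n
    · rw [derExt_zero]
      simp only [LinearMap.comp_apply, LinearMap.smul_apply, LinearMap.zero_apply, map_zero,
        smul_zero] at mg ⊢
      rw [mg, S0, map_zero]
    · rw [(T n h_n).2.2.2.1]
      simp only [LinearMap.comp_apply, LinearMap.smul_apply] at mf mg ⊢
      rw [← mf, γS n h_n a μ hμ, mg, map_smul, smul_smul, sq, one_smul]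
  refine ⟨⟨P₁, C.algA.perturb ht hder, C.algB.perturb hpert dt, mf, mg, ?_,
    fun n h_n => (T n h_n).2.2.2.2.contraction, ?_, ?_, ?_⟩, dt, hpert⟩
  · have e : tensorPow h 1 ∘ₗ tensorPow t 1 = tensorPow (h ∘ₗ t) 1 := (tensorPow_comp h t 1).symm
    have add1 : ∀ φ ψ : A →ₗ[k] A, tensorPow (φ + ψ) 1 = tensorPow φ 1 + tensorPow ψ 1 := by
      intro φ ψ
      rw [← derExt_one 𝒜 0, ← derExt_one 𝒜 0, ← derExt_one 𝒜 0, derExt_add]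
    have i1 : tensorPow (pertSeries h t) 1 =
        pertSeries (hn 1) (derExt 𝒜 (-1) t 1) := by
      have u1 := (T 1 le_rfl).1
      have r1 := pertSeries_eq_right hu
      -- Both sides become `t` on `A^{⊗1}` when composed with the invertible `1 - h t`.
      refine comp_right_cancel_of_isUnit u1 ?_
      rw [pertSeries_comp u1, C.hn_one, derExt_one, e, LinearMap.comp_sub,
        LinearMap.comp_id, ← tensorPow_comp, sub_eq_iff_eq_add, ← add1, ← r1]
    rw [perturbHn, ← i1, C.hn_one, add1, ← tensorPow_comp, ← tensorPow_comp]
  · intro n h_n a μ hμ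
    refine LinearMap.ext fun z => ?_
    simp only [perturbHn, LinearMap.comp_apply, LinearMap.add_apply, LinearMap.smul_apply,
      map_add, smul_add]
    rw [γh n h_n a μ hμ, γh n h_n a μ hμ, γS n h_n a μ hμ, γh n h_n a μ hμ]
    simp only [map_smul]
    rw [smul_smul (ksign k a) (ksign k a) (ksign k a • _), sq, one_smul]
  · intro p q hp hq
    rw [tensorHom_zero_id, tensorHom_one_id, tensorHom_one_eq]
    exact (C.perturb_split (T p hp).1 (T q hq).1 (T (p + q) (by omega)).1
      ht.deg (T p hp).2.2.2.2.contraction.h_deg hp hq).1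
  · intro p q hp hq
    rw [tensorHom_zero_id, tensorHom_one_id, tensorHom_one_eq]
    exact (C.perturb_split (T p hp).1 (T q hq).1 (T (p + q) (by omega)).1
      ht.deg (T p hp).2.2.2.2.contraction.h_deg hp hq).2

/-- The permutation commutes with `h_n` and with the derivation extending `t`, hence with their
series. -/
theorem perturbHn_equivariant {n : ℕ}
    (hu : IsUnit (LinearMap.id - hn n ∘ₗ derExt 𝒜 (-1) t n : Module.End k (⨂[k]^n A)))
    (ht : IsHomog 𝒜 𝒜 (-1) t) (σ : Equiv.Perm (Fin n))
    (hσ : koszulPerm 𝒜 σ ∘ₗ hn n = hn n ∘ₗ koszulPerm 𝒜 σ) :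
    koszulPerm 𝒜 σ ∘ₗ perturbHn 𝒜 t hn n = perturbHn 𝒜 t hn n ∘ₗ koszulPerm 𝒜 σ := by
  have e := pertSeries_intertwine (one_mul (1 : k)) hu hu (by rw [hσ, one_smul])
    (by rw [koszulPerm_comp_derExt (by decide) ht σ, one_smul])
  rw [one_smul] at e
  rw [perturbHn, LinearMap.comp_add, LinearMap.add_comp, hσ]
  congr 1
  refine LinearMap.ext fun z => ?_
  have hσ' := LinearMap.congr_fun hσ
  have e' := LinearMap.congr_fun e
  simp only [LinearMap.comp_apply] at hσ' e' ⊢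
  rw [hσ', e', hσ']

end Operadic

end HPT

theorem theoremA {k : Type*} [CommRing k] (O : HPT.Operad k)
    {A : Type*} [AddCommGroup A] [Module k A] {B : Type*} [AddCommGroup B] [Module k B]
    (𝒜 : ℤ → Submodule k A) [DirectSum.Decomposition 𝒜]
    (ℬ : ℤ → Submodule k B) [DirectSum.Decomposition ℬ]
    (dA : A →ₗ[k] A) (dB : B →ₗ[k] B)
    (γA : ∀ n, O.obj n →ₗ[k] (TensorPower k n A →ₗ[k] A))
    (γB : ∀ n, O.obj n →ₗ[k] (TensorPower k n B →ₗ[k] B))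
    (FA : ℤ → Submodule k A) (FB : ℤ → Submodule k B)
    (f : A →ₗ[k] B) (g : B →ₗ[k] A) (h t : A →ₗ[k] A)
    (hD : HPT.IsFilteredOpContraction O 𝒜 ℬ dA dB γA γB FA FB f g h)
    (ht : HPT.IsPerturbation 𝒜 dA t)
    (ht_lowers : ∀ p, ∀ x ∈ FA p, t x ∈ FA (p - 1))
    (ht_der : HPT.IsOpDerivation O 𝒜 γA (-1) t) :
    -- the series `Σ = ∑ t (h t) ^ n` converges pointwise to a linear map `S = t (1 - h t)⁻¹`
    ∃ S : A →ₗ[k] A,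
      (∀ x, {n : ℕ | t (((h ∘ₗ t) ^ n) x) ≠ 0}.Finite ∧
        S x = ∑ᶠ n : ℕ, t (((h ∘ₗ t) ^ n) x)) ∧
      IsUnit (LinearMap.id - h ∘ₗ t : Module.End k A) ∧
      S ∘ₗ (LinearMap.id - h ∘ₗ t) = t ∧
      -- `t'` is a perturbation of `B`, and the perturbed data form a filtered contraction
      HPT.IsPerturbation ℬ dB (f ∘ₗ S ∘ₗ g) ∧
      HPT.IsFilteredOpContraction O 𝒜 ℬ (dA + t) (dB + f ∘ₗ S ∘ₗ g) γA γB FA FB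
        (f + f ∘ₗ S ∘ₗ h) (g + h ∘ₗ S ∘ₗ g) (h + h ∘ₗ S ∘ₗ h) ∧
      -- with symmetric higher homotopies if the given ones can be chosen symmetric
      (HPT.IsSymmFilteredOpContraction O 𝒜 ℬ dA dB γA γB FA FB f g h →
        HPT.IsSymmFilteredOpContraction O 𝒜 ℬ (dA + t) (dB + f ∘ₗ S ∘ₗ g) γA γB FA FB
          (f + f ∘ₗ S ∘ₗ h) (g + h ∘ₗ S ∘ₗ g) (h + h ∘ₗ S ∘ₗ h)) ∧
      -- in particular
      HPT.IsOpMorphism O 𝒜 ℬ (dA + t) (dB + f ∘ₗ S ∘ₗ g) γA γB (f + f ∘ₗ S ∘ₗ h) ∧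
      HPT.IsOpMorphism O ℬ 𝒜 (dB + f ∘ₗ S ∘ₗ g) (dA + t) γB γA (g + h ∘ₗ S ∘ₗ g) ∧
      HPT.IsOpDerivation O ℬ γB (-1) (f ∘ₗ S ∘ₗ g) ∧
      HPT.IsOpAlgebra O ℬ (dB + f ∘ₗ S ∘ₗ g) γB := by
  obtain ⟨hb, hn, C, hf⟩ := hD
  have hφ := hb.perturb_lowers ht_lowers
  obtain ⟨C', hder', hpert'⟩ := C.perturb hb hf ht ht_lowers ht_der
  have hb' := hb.perturb ht ht_lowers
  refine ⟨HPT.pertSeries h t, fun x => ⟨HPT.pertSeries_finite_support hφ x,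
    HPT.pertSeries_eq_finsum hφ x⟩, HPT.isUnit_id_sub hφ,
    HPT.pertSeries_comp (HPT.isUnit_id_sub hφ), hpert',
    ⟨hb', _, C', fun n h_n => (C.perturb_tensor hb hf ht ht_lowers h_n).2.2.2.2⟩, ?_, C'.morf,
    C'.morg, hder', C'.algB⟩
  -- The symmetric homotopies may differ from those chosen before; the perturbed `f`, `g`, `h` do
  -- not depend on this choice, since the series involves only `h` and `t`.
  rintro ⟨-, hn, C, hf, hσ⟩
  exact ⟨hb', _, (C.perturb hb hf ht ht_lowers ht_der).1,
    fun n h_n => (C.perturb_tensor hb hf ht ht_lowers h_n).2.2.2.2, fun n h_n σ =>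
    HPT.perturbHn_equivariant (C.perturb_tensor hb hf ht ht_lowers h_n).1 ht.deg σ (hσ n h_n σ)⟩
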